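/- Conventions. Manifolds are smooth, Hausdorff and paracompact, and each is modelled on a real Banach space (finite-dimensional manifolds are the main case). A bundle gerbe $(P,X)$ on a manifold $M$ consists of a smooth surjection $\pi\colon X\to M$ from a manifold $X$ which admits a smooth local section through every point of $X$, a smooth principal $\mathbb C^\times$-bundle $P$ on $X^{[2]}=X\times_M X$, and a product, i.e. a smooth isomorphism of $\mathbb C^\times$-bundles on $X^{[3]}$ which is fibrewise $P_{(x_2,x_3)}\otimes P_{(x_1,x_2)}\to P_{(x_1,x_3)}$, $v\otimes u\mapsto vu$, and which is associative over $X^{[4]}$. A bundle gerbe morphism $f\colon (P,X)\to (Q,Y)$ is a smooth map $f\colon X\to Y$ over $M$ together with a smooth map of $\mathbb C^\times$-bundles $\hat f\colon P\to Q$ covering $f^{[2]}$ and preserving the products. A transformation $\theta\colon f\Rightarrow g$ between morphisms $f,g\colon P\to Q$ is a section of the $\mathbb C^\times$-bundle $D_{f,g}$ on $M$ obtained by descent from $(f,g)^{-1}Q$ on $X$; equivalently, it is a smooth section $x\mapsto\theta(x)\in Q_{(f(x),g(x))}$ of $(f,g)^{-1}Q$ with $\theta(x_2)\hat f(u)=\hat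 g(u)\theta(x_1)$ for all $u\in P_{(x_1,x_2)}$. Transformations compose vertically by $(\lambda\theta)(x)=\lambda(x)\theta(x)$, and for a morphism $h$ they can be whiskered: $(h\circ\theta)(x)=\hat h(\theta(x))$ and $(\theta\circ h)(x)=\theta(h(x))$. Write $U_{ij}=U_i\cap U_j$, and so on. Proposition. Let $\{U_i\}_{i\in I}$ be an open cover of a manifold $M$. Suppose we are given bundle gerbes $Q_i$ on $U_i$, bundle gerbe morphisms $\phi_{ij}\colon Q_i|_{U_{ij}}\to Q_j|_{U_{ij}}$ for all $i,j$, and transformations $\psi_{ijk}\colon \phi_{jk}\circ\phi_{ij}\Rightarrow\phi_{ik}$ over $U_{ijk}$ for all $i,j,k$, satisfying the non-abelian 2-cocycle condition: for all $i,j,k,l$, $$\psi_{ikl}\,(\phi_{kl}\circ\psi_{ijk})=\psi_{ijl}\,(\psi_{jkl}\circ\phi_{ij})$$ as transformations $\phi_{kl}\circ\phi_{jk}\circ\phi_{ij}\Rightarrow\phi_{il}$ over $U_{ijkl}$. Then there exist a bundle gerbe $Q$ on $M$, bundle gerbe morphisms $\chi_i\colon Q|_{U_i}\to Q_i$ over $U_i$,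 and transformations $\xi_{ij}\colon \phi_{ij}\circ\chi_i\Rightarrow\chi_j$ over $U_{ij}$ which are compatible with the $\psi_{ijk}$: for all $i,j,k$, $$\xi_{jk}\,(\phi_{jk}\circ\xi_{ij})=\xi_{ik}\,(\psi_{ijk}\circ\chi_i)$$ as transformations $\phi_{jk}\circ\phi_{ij}\circ\chi_i\Rightarrow\chi_k$ over $U_{ijk}$. Moreover, if $M$ and the manifolds underlying all the $Q_i$ are finite-dimensional, then $Q$ can be chosen so that its underlying manifold is finite-dimensional. -/

import Mathlib

open scoped Manifold ContDiff Topology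
open TopologicalSpace (Opens)

universe u v

/-- A (smooth) principal `ℂˣ`-bundle over the subset `R` of the manifold `Z`; in the applications
`R` is a (split) submanifold of `Z`.

* `fib z` is the fibre over `z`; it is empty for `z ∉ R`, and for `z ∈ R` it is a nonempty set on
  which `ℂˣ` acts simply transitively. So the total space is `Σ z, fib z`, with projection onto `R`.
* The smooth structure is given by an atlas of local trivialisations with smooth transition
  functions. A local trivialisation over `τ.1 ∩ R` (with `τ.1` open in `Z`) is recorded by its
  `ℂˣ`-component, a `ℂˣ`-equivariant function `τ.2` on the part of the total space over `τ.1`;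
  the values of `τ.2` over points outside `τ.1` play no role.
* A function on `R` is smooth if it is smooth within `R` as a function on `Z`. -/
structure PrincipalBundle {F : Type*} [NormedAddCommGroup F] [NormedSpace ℝ F]
    {H : Type*} [TopologicalSpace H] (J : ModelWithCorners ℝ F H)
    (Z : Type u) [TopologicalSpace Z] [ChartedSpace H Z] (R : Set Z) where
  fib : Z → Type u
  [act : ∀ z, MulAction ℂˣ (fib z)]
  nonempty_fib_iff : ∀ z, Nonempty (fib z) ↔ z ∈ R
  existsUnique_smul : ∀ {z} (a b : fib z), ∃! c : ℂˣ, c • a = b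
  atlas : Set (Opens Z × (∀ z, fib z → ℂˣ))
  equivariant : ∀ τ ∈ atlas, ∀ z ∈ τ.1, ∀ (c : ℂˣ) (a : fib z), τ.2 z (c • a) = c * τ.2 z a
  exists_mem_atlas : ∀ z ∈ R, ∃ τ ∈ atlas, z ∈ τ.1
  smooth_transition : ∀ τ ∈ atlas, ∀ σ ∈ atlas, ∀ z₀ ∈ R, z₀ ∈ τ.1 → z₀ ∈ σ.1 →
    ∃ g : Z → ℂˣ, ContMDiffWithinAt J 𝓘(ℝ, ℂ) ∞ (fun z => (g z : ℂ)) R z₀ ∧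
      ∀ᶠ z in 𝓝[R] z₀, ∀ a : fib z, σ.2 z a = g z * τ.2 z a

attribute [instance] PrincipalBundle.act

section

variable {E : Type v} [NormedAddCommGroup E] [NormedSpace ℝ E]
variable {M : Type u} [TopologicalSpace M] [ChartedSpace E M]

/-- A bundle gerbe `(P, X, U)` over the open subset `U` of the manifold `M`.

`X` is a manifold, modelled on the Banach space `V`, and `π : X → M` is a smooth map with image `U`
that has a smooth local section through every point of `X`. (Equivalently, `π` is a surjective
submersion onto `U`, so that the fibre products `X^[p]` over `M` are submanifolds of `X^p`.)
`P` is a principal `ℂˣ`-bundle over `X^[2] = {(x, y) | π x = π y}`, and `mul` is the bundle gerbe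
product `P_(y,z) ⊗ P_(x,y) → P_(x,z)`: an isomorphism of `ℂˣ`-bundles over `X^[3]`, that is, a
smooth map that is `ℂˣ`-equivariant in each variable. It is associative over `X^[4]`. -/
structure BundleGerbe (U : Opens M) where
  V : Type v
  [normedAddCommGroup : NormedAddCommGroup V]
  [normedSpace : NormedSpace ℝ V]
  [completeSpace : CompleteSpace V]
  X : Type u
  [topologicalSpace : TopologicalSpace X]
  [chartedSpace : ChartedSpace V X]
  [isManifold : IsManifold 𝓘(ℝ, V) ∞ X]
  [t2Space : T2Space X]
  [paracompactSpace : ParacompactSpace X]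
  π : X → M
  smooth_π : ContMDiff 𝓘(ℝ, V) 𝓘(ℝ, E) ∞ π
  range_π : Set.range π = U
  exists_section : ∀ x : X, ∃ (W : Set M) (s : M → X), IsOpen W ∧ π x ∈ W ∧
    ContMDiffOn 𝓘(ℝ, E) 𝓘(ℝ, V) ∞ s W ∧ s (π x) = x ∧ ∀ m ∈ W, π (s m) = m
  P : PrincipalBundle (𝓘(ℝ, V).prod 𝓘(ℝ, V)) (X × X) {p | π p.1 = π p.2}
  mul : ∀ {x y z : X}, P.fib (y, z) → P.fib (x, y) → P.fib (x, z)
  smul_mul : ∀ {x y z : X} (c : ℂˣ) (b : P.fib (y, z)) (a : P.fib (x, y)),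
    mul (c • b) a = c • mul b a
  mul_smul : ∀ {x y z : X} (c : ℂˣ) (b : P.fib (y, z)) (a : P.fib (x, y)),
    mul b (c • a) = c • mul b a
  smooth_mul : ∀ x₀ y₀ z₀ : X, π x₀ = π y₀ → π y₀ = π z₀ →
    ∀ τ ∈ P.atlas, ∀ σ ∈ P.atlas, ∀ ρ ∈ P.atlas,
      (y₀, z₀) ∈ τ.1 → (x₀, y₀) ∈ σ.1 → (x₀, z₀) ∈ ρ.1 →
      ∃ g : X × X × X → ℂˣ,
        ContMDiffWithinAt (𝓘(ℝ, V).prod (𝓘(ℝ, V).prod 𝓘(ℝ, V))) 𝓘(ℝ, ℂ) ∞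
          (fun p => (g p : ℂ)) {p | π p.1 = π p.2.1 ∧ π p.2.1 = π p.2.2} (x₀, y₀, z₀) ∧
        ∀ᶠ p in 𝓝[{p | π p.1 = π p.2.1 ∧ π p.2.1 = π p.2.2}] (x₀, y₀, z₀),
          ∀ (b : P.fib (p.2.1, p.2.2)) (a : P.fib (p.1, p.2.1)),
            ρ.2 _ (mul b a) = g p * (τ.2 _ b * σ.2 _ a)
  mul_assoc : ∀ {w x y z : X} (c : P.fib (y, z)) (b : P.fib (x, y)) (a : P.fib (w, x)),
    mul c (mul b a) = mul (mul c b) a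

namespace BundleGerbe

attribute [instance] normedAddCommGroup normedSpace completeSpace topologicalSpace chartedSpace
  isManifold t2Space paracompactSpace

/-- The open submanifold `X|_V = π⁻¹(V)` of `X`; the restriction of the bundle gerbe `(P, X)` to
`V` is the restriction of `P` and of its product to `X|_V`. -/
def restr {U : Opens M} (P : BundleGerbe (E := E) U) (V : Opens M) : Opens P.X :=
  ⟨P.π ⁻¹' V, V.isOpen.preimage P.smooth_π.continuous⟩

/-- For open `V ⊆ U ∩ U'` and bundle gerbes `P` over `U`, `Q` over `U'`: the bundle gerbe morphisms
`P|_V → Q|_V` (covering the identity of `V`). Such a morphism consists of a smooth map `f` on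
`X|_V` commuting with the projections to `M`, and a smooth map of `ℂˣ`-bundles `P|_V → Q|_V` that
covers `f^[2]` and preserves the bundle gerbe products. (As `f` commutes with the projections, it
takes values in the part of `Q.X` over `V`.) -/
structure Hom (V : Opens M) {U U' : Opens M} (P : BundleGerbe (E := E) U)
    (Q : BundleGerbe (E := E) U') where
  f : P.restr V → Q.X
  smooth_f : ContMDiff 𝓘(ℝ, P.V) 𝓘(ℝ, Q.V) ∞ f
  π_f : ∀ x, Q.π (f x) = P.π x
  fhat : ∀ {x y : P.restr V}, P.P.fib (x, y) → Q.P.fib (f x, f y)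
  fhat_smul : ∀ {x y : P.restr V} (c : ℂˣ) (a : P.P.fib (x, y)), fhat (c • a) = c • fhat a
  smooth_fhat : ∀ x₀ y₀ : P.restr V, P.π x₀ = P.π y₀ → ∀ τ ∈ P.P.atlas, ∀ σ ∈ Q.P.atlas,
    (↑x₀, ↑y₀) ∈ τ.1 → (f x₀, f y₀) ∈ σ.1 →
    ∃ g : P.restr V × P.restr V → ℂˣ,
      ContMDiffWithinAt (𝓘(ℝ, P.V).prod 𝓘(ℝ, P.V)) 𝓘(ℝ, ℂ) ∞ (fun p => (g p : ℂ))
        {p | P.π p.1 = P.π p.2} (x₀, y₀) ∧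
      ∀ᶠ p in 𝓝[{p | P.π p.1 = P.π p.2}] (x₀, y₀),
        ∀ a : P.P.fib (p.1, p.2), σ.2 _ (fhat a) = g p * τ.2 _ a
  fhat_mul : ∀ {x y z : P.restr V} (b : P.P.fib (y, z)) (a : P.P.fib (x, y)),
    fhat (P.mul b a) = Q.mul (fhat b) (fhat a)

/-- A transformation `f ⇒ g` between bundle gerbe morphisms `f, g : P|_V → Q|_V`: a section of the
`ℂˣ`-bundle `D_{f,g}` on `V` obtained by descent from the bundle `(f, g)⁻¹Q` on `X|_V` with fibre
`Q_(f(x),g(x))` at `x`. Here the descent isomorphism takes `v` in the fibre at `x` to the element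
`v'` of the fibre at `y` with `v' f̂(a) = ĝ(a) v`, for any `a ∈ P_(x,y)`. The sections of the
descended bundle are the smooth sections of `(f, g)⁻¹Q` that are preserved by the descent
isomorphism. -/
structure Trans {V U U' : Opens M} {P : BundleGerbe (E := E) U} {Q : BundleGerbe (E := E) U'}
    (f g : Hom V P Q) where
  app : ∀ x : P.restr V, Q.P.fib (f.f x, g.f x)
  smooth_app : ∀ x₀, ∀ τ ∈ Q.P.atlas, (f.f x₀, g.f x₀) ∈ τ.1 →
    ContMDiffAt 𝓘(ℝ, P.V) 𝓘(ℝ, ℂ) ∞ (fun x => (τ.2 _ (app x) : ℂ)) x₀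
  naturality : ∀ {x y : P.restr V} (a : P.P.fib (x, y)),
    Q.mul (app y) (f.fhat a) = Q.mul (g.fhat a) (app x)

variable {U U' U'' : Opens M} {P : BundleGerbe (E := E) U} {Q : BundleGerbe (E := E) U'}
  {R : BundleGerbe (E := E) U''}

theorem contMDiffWithinAt_mul_complex {A : Type*} [NormedAddCommGroup A] [NormedSpace ℝ A]
    {H : Type*} [TopologicalSpace H] {J : ModelWithCorners ℝ A H} {N : Type*} [TopologicalSpace N]
    [ChartedSpace H N] {k l : N → ℂ} {s : Set N} {x : N}
    (hk : ContMDiffWithinAt J 𝓘(ℝ, ℂ) ∞ k s x) (hl : ContMDiffWithinAt J 𝓘(ℝ, ℂ) ∞ l s x) :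
    ContMDiffWithinAt J 𝓘(ℝ, ℂ) ∞ (fun y => k y * l y) s x :=
  ((contDiff_mul (𝕜 := ℝ) (𝔸 := ℂ)).contDiffAt.contMDiffAt).comp_contMDiffWithinAt x
    (hk.prodMk_space hl)

/-- The map `X|_V → Y|_V` underlying a bundle gerbe morphism over `V`. -/
def Hom.onRestr {V : Opens M} (f : Hom V P Q) (x : P.restr V) : Q.restr V :=
  ⟨f.f x, show Q.π (f.f x) ∈ V from (f.π_f x).symm ▸ x.2⟩

theorem Hom.smooth_onRestr {V : Opens M} (f : Hom V P Q) :
    ContMDiff 𝓘(ℝ, P.V) 𝓘(ℝ, Q.V) ∞ f.onRestr :=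
  (ContMDiff.subtypeVal_comp_iff _ _).1 f.smooth_f

theorem Hom.smooth_onRestr_prod {V : Opens M} (f : Hom V P Q) :
    ContMDiff (𝓘(ℝ, P.V).prod 𝓘(ℝ, P.V)) (𝓘(ℝ, Q.V).prod 𝓘(ℝ, Q.V)) ∞
      (fun p : P.restr V × P.restr V => (f.onRestr p.1, f.onRestr p.2)) :=
  (f.smooth_onRestr.comp contMDiff_fst).prodMk (f.smooth_onRestr.comp contMDiff_snd)

/-- The composite `g ∘ f` of bundle gerbe morphisms over `V`. -/
def Hom.comp {V : Opens M} (g : Hom V Q R) (f : Hom V P Q) : Hom V P R where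
  f x := g.f (f.onRestr x)
  smooth_f := g.smooth_f.comp f.smooth_onRestr
  π_f x := (g.π_f _).trans (f.π_f x)
  fhat a := g.fhat (x := f.onRestr _) (y := f.onRestr _) (f.fhat a)
  fhat_smul c a := by
    rw [f.fhat_smul]; exact g.fhat_smul (x := f.onRestr _) (y := f.onRestr _) c _
  smooth_fhat x₀ y₀ h τ hτ ρ hρ hτ₀ hρ₀ := by
    have h' : Q.π (f.f x₀) = Q.π (f.f y₀) := by rw [f.π_f, f.π_f, h]
    obtain ⟨σ, hσ, hσ₀⟩ := Q.P.exists_mem_atlas (f.f x₀, f.f y₀) h'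
    obtain ⟨k, hk, hk'⟩ := f.smooth_fhat x₀ y₀ h τ hτ σ hσ hτ₀ hσ₀
    obtain ⟨l, hl, hl'⟩ := g.smooth_fhat (f.onRestr x₀) (f.onRestr y₀) h' σ hσ ρ hρ hσ₀ hρ₀
    have hmaps : Set.MapsTo (fun p : P.restr V × P.restr V => (f.onRestr p.1, f.onRestr p.2))
        {p | P.π p.1 = P.π p.2} {p | Q.π p.1 = Q.π p.2} := by
      intro p hp
      change Q.π (f.f p.1) = Q.π (f.f p.2)
      rw [f.π_f, f.π_f]; exact hp
    refine ⟨fun p => l (f.onRestr p.1, f.onRestr p.2) * k p, ?_, ?_⟩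
    · have hc := ContMDiffWithinAt.comp (x₀, y₀) hl
        (f.smooth_onRestr_prod.contMDiffAt.contMDiffWithinAt) hmaps
      simpa using contMDiffWithinAt_mul_complex hc hk
    · have ht : Filter.Tendsto
          (fun p : P.restr V × P.restr V => (f.onRestr p.1, f.onRestr p.2))
          (𝓝[{p | P.π p.1 = P.π p.2}] (x₀, y₀))
          (𝓝[{p | Q.π p.1 = Q.π p.2}] (f.onRestr x₀, f.onRestr y₀)) :=
        f.smooth_onRestr_prod.continuous.continuousWithinAt.tendsto_nhdsWithin hmaps
      filter_upwards [hk', ht.eventually hl'] with p hp hp' a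
      exact (hp' (f.fhat a)).trans ((congrArg _ (hp a)).trans (_root_.mul_assoc _ _ _).symm)
  fhat_mul b a := by
    rw [f.fhat_mul]
    exact g.fhat_mul (x := f.onRestr _) (y := f.onRestr _) (z := f.onRestr _) _ _

theorem restr_mono {V W : Opens M} (h : W ≤ V) : P.restr W ≤ P.restr V := fun _ hx => h hx

/-- The inclusion `X|_W → X|_V` for `W ⊆ V`. -/
def incl {V W : Opens M} (h : W ≤ V) (x : P.restr W) : P.restr V := ⟨x, h x.2⟩

theorem smooth_incl {V W : Opens M} (h : W ≤ V) :
    ContMDiff 𝓘(ℝ, P.V) 𝓘(ℝ, P.V) ∞ (incl h : P.restr W → P.restr V) :=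
  contMDiff_inclusion (restr_mono h)

/-- The restriction of a bundle gerbe morphism over `V` to a smaller open set `W`. -/
def Hom.res {V W : Opens M} (h : W ≤ V) (f : Hom V P Q) : Hom W P Q where
  f x := f.f (incl h x)
  smooth_f := f.smooth_f.comp (smooth_incl h)
  π_f x := f.π_f (incl h x)
  fhat a := f.fhat (x := incl h _) (y := incl h _) a
  fhat_smul c a := f.fhat_smul (x := incl h _) (y := incl h _) c a
  smooth_fhat x₀ y₀ h₀ τ hτ σ hσ hτ₀ hσ₀ := by
    obtain ⟨k, hk, hk'⟩ := f.smooth_fhat (incl h x₀) (incl h y₀) h₀ τ hτ σ hσ hτ₀ hσ₀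
    have hs : ContMDiff (𝓘(ℝ, P.V).prod 𝓘(ℝ, P.V)) (𝓘(ℝ, P.V).prod 𝓘(ℝ, P.V)) ∞
        (fun p : P.restr W × P.restr W => (incl h p.1, incl h p.2)) :=
      ((smooth_incl h).comp contMDiff_fst).prodMk ((smooth_incl h).comp contMDiff_snd)
    have hmaps : Set.MapsTo (fun p : P.restr W × P.restr W => (incl h p.1, incl h p.2))
        {p | P.π p.1 = P.π p.2} {p | P.π p.1 = P.π p.2} := fun p hp => hp
    refine ⟨fun p => k (incl h p.1, incl h p.2), ?_, ?_⟩
    · exact ContMDiffWithinAt.comp (g := fun p => (k p : ℂ)) (x₀, y₀) hk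
        hs.contMDiffAt.contMDiffWithinAt hmaps
    · have ht : Filter.Tendsto (fun p : P.restr W × P.restr W => (incl h p.1, incl h p.2))
          (𝓝[{p | P.π p.1 = P.π p.2}] (x₀, y₀))
          (𝓝[{p | P.π p.1 = P.π p.2}] (incl h x₀, incl h y₀)) :=
        hs.continuous.continuousWithinAt.tendsto_nhdsWithin hmaps
      filter_upwards [ht.eventually hk'] with p hp a
      exact hp a
  fhat_mul b a := f.fhat_mul (x := incl h _) (y := incl h _) (z := incl h _) b a

namespace Trans

/-- The restriction of a transformation to a smaller open set. -/
def res {V W : Opens M} (h : W ≤ V) {f g : Hom V P Q} (θ : Trans f g) :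
    Trans (f.res h) (g.res h) where
  app x := θ.app (incl h x)
  smooth_app x₀ τ hτ h₀ :=
    ContMDiffAt.comp (g := fun x => (τ.2 _ (θ.app x) : ℂ)) x₀ (θ.smooth_app (incl h x₀) τ hτ h₀) (smooth_incl h).contMDiffAt
  naturality a := θ.naturality (x := incl h _) (y := incl h _) a

/-- The vertical composite `f ⇒ g ⇒ k` of transformations. -/
def vcomp {V : Opens M} {f g k : Hom V P Q} (η : Trans g k) (θ : Trans f g) : Trans f k where
  app x := Q.mul (η.app x) (θ.app x)
  smooth_app x₀ ρ hρ h₀ := by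
    have hfg : Q.π (f.f x₀) = Q.π (g.f x₀) := by rw [f.π_f, g.π_f]
    have hgk : Q.π (g.f x₀) = Q.π (k.f x₀) := by rw [g.π_f, k.π_f]
    obtain ⟨σ, hσ, hσ₀⟩ := Q.P.exists_mem_atlas (f.f x₀, g.f x₀) hfg
    obtain ⟨τ, hτ, hτ₀⟩ := Q.P.exists_mem_atlas (g.f x₀, k.f x₀) hgk
    obtain ⟨l, hl, hl'⟩ := Q.smooth_mul _ _ _ hfg hgk τ hτ σ hσ ρ hρ hτ₀ hσ₀ h₀
    have hs : ContMDiff 𝓘(ℝ, P.V) (𝓘(ℝ, Q.V).prod (𝓘(ℝ, Q.V).prod 𝓘(ℝ, Q.V))) ∞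
        (fun x : P.restr V => (f.f x, g.f x, k.f x)) :=
      f.smooth_f.prodMk (g.smooth_f.prodMk k.smooth_f)
    have hmaps : Set.MapsTo (fun x : P.restr V => (f.f x, g.f x, k.f x)) Set.univ
        {p | Q.π p.1 = Q.π p.2.1 ∧ Q.π p.2.1 = Q.π p.2.2} := by
      intro x _
      constructor
      · change Q.π (f.f x) = Q.π (g.f x)
        rw [f.π_f, g.π_f]
      · change Q.π (g.f x) = Q.π (k.f x)
        rw [g.π_f, k.π_f]
    have hc := ContMDiffWithinAt.comp x₀ hl hs.contMDiffAt.contMDiffWithinAt hmaps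
    have ht := (hs.continuous.continuousWithinAt (s := Set.univ)
      (x := x₀)).tendsto_nhdsWithin hmaps
    rw [nhdsWithin_univ] at ht
    refine ContMDiffAt.congr_of_eventuallyEq
      (contMDiffWithinAt_univ.1 (contMDiffWithinAt_mul_complex hc
        (contMDiffWithinAt_mul_complex (contMDiffWithinAt_univ.2 (η.smooth_app x₀ τ hτ hτ₀))
          (contMDiffWithinAt_univ.2 (θ.smooth_app x₀ σ hσ hσ₀))))) ?_
    filter_upwards [ht.eventually hl'] with x hx
    simpa using congrArg Units.val (hx (η.app x) (θ.app x))
  naturality a := by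
    rw [← Q.mul_assoc, θ.naturality, Q.mul_assoc, η.naturality, Q.mul_assoc]

/-- The horizontal composite of the identity of `g` with `θ : f ⇒ f'`, a transformation
`g ∘ f ⇒ g ∘ f'`. -/
def whiskerLeft {V : Opens M} (g : Hom V Q R) {f f' : Hom V P Q} (θ : Trans f f') :
    Trans (g.comp f) (g.comp f') where
  app x := g.fhat (x := f.onRestr x) (y := f'.onRestr x) (θ.app x)
  smooth_app x₀ ρ hρ h₀ := by
    have hff : Q.π (f.f x₀) = Q.π (f'.f x₀) := by rw [f.π_f, f'.π_f]
    obtain ⟨σ, hσ, hσ₀⟩ := Q.P.exists_mem_atlas (f.f x₀, f'.f x₀) hff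
    obtain ⟨l, hl, hl'⟩ := g.smooth_fhat (f.onRestr x₀) (f'.onRestr x₀) hff σ hσ ρ hρ hσ₀ h₀
    have hs : ContMDiff 𝓘(ℝ, P.V) (𝓘(ℝ, Q.V).prod 𝓘(ℝ, Q.V)) ∞
        (fun x : P.restr V => (f.onRestr x, f'.onRestr x)) :=
      f.smooth_onRestr.prodMk f'.smooth_onRestr
    have hmaps : Set.MapsTo (fun x : P.restr V => (f.onRestr x, f'.onRestr x)) Set.univ
        {p | Q.π p.1 = Q.π p.2} := by
      intro x _
      change Q.π (f.f x) = Q.π (f'.f x)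
      rw [f.π_f, f'.π_f]
    have hc := ContMDiffWithinAt.comp x₀ hl hs.contMDiffAt.contMDiffWithinAt hmaps
    have ht := (hs.continuous.continuousWithinAt (s := Set.univ)
      (x := x₀)).tendsto_nhdsWithin hmaps
    rw [nhdsWithin_univ] at ht
    refine ContMDiffAt.congr_of_eventuallyEq
      (contMDiffWithinAt_univ.1 (contMDiffWithinAt_mul_complex hc
        (contMDiffWithinAt_univ.2 (θ.smooth_app x₀ σ hσ hσ₀)))) ?_
    filter_upwards [ht.eventually hl'] with x hx
    exact (congrArg Units.val (hx (θ.app x))).trans (Units.val_mul _ _)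
  naturality {x y} a := by
    have h := congrArg (g.fhat (x := f.onRestr x) (y := f'.onRestr y)) (θ.naturality a)
    exact (g.fhat_mul (x := f.onRestr x) (y := f.onRestr y) (z := f'.onRestr y) _ _).symm.trans
      (h.trans (g.fhat_mul (x := f.onRestr x) (y := f'.onRestr x) (z := f'.onRestr y) _ _))

/-- The horizontal composite of `θ : g ⇒ g'` with the identity of `f`, a transformation
`g ∘ f ⇒ g' ∘ f`. -/
def whiskerRight {V : Opens M} {g g' : Hom V Q R} (θ : Trans g g') (f : Hom V P Q) :
    Trans (g.comp f) (g'.comp f) where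
  app x := θ.app (f.onRestr x)
  smooth_app x₀ τ hτ h₀ :=
    ContMDiffAt.comp (g := fun x => (τ.2 _ (θ.app x) : ℂ)) x₀ (θ.smooth_app (f.onRestr x₀) τ hτ h₀) f.smooth_onRestr.contMDiffAt
  naturality a := θ.naturality (x := f.onRestr _) (y := f.onRestr _) (f.fhat a)

end Trans

end BundleGerbe

open BundleGerbe

/-- 2-descent data `(Q_i, φ_ij, ψ_ijk)` for bundle gerbes, relative to a family of open sets `U_i`:
bundle gerbes `Q_i` over `U_i`, bundle gerbe morphisms `φ_ij : Q_i|_{U_ij} → Q_j|_{U_ij}`, and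
transformations `ψ_ijk : φ_jk ∘ φ_ij ⇒ φ_ik` over `U_ijk` that satisfy the non-abelian 2-cocycle
condition: over `U_ijkl`, the two transformations `φ_kl ∘ φ_jk ∘ φ_ij ⇒ φ_il`, through
`φ_kl ∘ φ_ik` and through `φ_jl ∘ φ_ij`, are equal. -/
structure TwoDescentData {ι : Type*} (U : ι → Opens M) where
  Q : ∀ i, BundleGerbe (E := E) (U i)
  φ : ∀ i j, Hom (U i ⊓ U j) (Q i) (Q j)
  ψ : ∀ i j k, Trans (V := U i ⊓ U j ⊓ U k)
    (((φ j k).res (le_inf (inf_le_left.trans inf_le_right) inf_le_right)).comp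
      ((φ i j).res inf_le_left))
    ((φ i k).res (le_inf (inf_le_left.trans inf_le_left) inf_le_right))
  cocycle : ∀ i j k l,
    have hij : U i ⊓ U j ⊓ U k ⊓ U l ≤ U i ⊓ U j := inf_le_left.trans inf_le_left
    have hkl : U i ⊓ U j ⊓ U k ⊓ U l ≤ U k ⊓ U l :=
      le_inf (inf_le_left.trans inf_le_right) inf_le_right
    have hijk : U i ⊓ U j ⊓ U k ⊓ U l ≤ U i ⊓ U j ⊓ U k := inf_le_left
    have hijl : U i ⊓ U j ⊓ U k ⊓ U l ≤ U i ⊓ U j ⊓ U l := le_inf hij inf_le_right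
    have hikl : U i ⊓ U j ⊓ U k ⊓ U l ≤ U i ⊓ U k ⊓ U l :=
      le_inf (le_inf (hij.trans inf_le_left) (hijk.trans inf_le_right)) inf_le_right
    have hjkl : U i ⊓ U j ⊓ U k ⊓ U l ≤ U j ⊓ U k ⊓ U l :=
      le_inf (le_inf (hij.trans inf_le_right) (hijk.trans inf_le_right)) inf_le_right
    Trans.vcomp ((ψ i k l).res hikl) (Trans.whiskerLeft ((φ k l).res hkl) ((ψ i j k).res hijk)) =
      Trans.vcomp ((ψ i j l).res hijl) (Trans.whiskerRight ((ψ j k l).res hjkl) ((φ i j).res hij))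

end

/-! Choose smooth local sections `s_a : W_a → Q_i`, with `i = idx a`, around all points `a` of `M`,
and let the manifold under `Q` be the disjoint union of the `W_a`. The disjoint union of the `Q_i`
themselves would not do, since they may have different model spaces; the `W_a` are open in `M`, so
`Q` is modelled on `E`, and the claim about finite dimension is immediate.

For `z` in `Q_i` and `w` in `Q_j` over the same point, the fibre of the glued bundle is that of
`Q_j` at `(φ_ij z, w)`. An element `a` of it has an image `â_k = φ_jk(a) ψ_ijk(z)⁻¹` in the fibre of
`Q_k` at `(φ_ik z, φ_jk w)`, and the product of `b`, whose second point lies in `Q_k`, with `a` is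
`b â_k`.

Everything algebraic rests on two identities. `Fib.hat_naturality` says that `ψ_ikl(z)` and
`ψ_jkl(w)` intertwine `φ_kl(â_k)` with `â_l`; this uses the cocycle condition and naturality of `ψ`.
It implies `Fib.hat_mul`: `a ↦ â_l` is multiplicative. Associativity follows at once. Moreover `χ_i`
is `x ↦ φ_ri(s_a(x))` on `W_a`, with `r = idx a`, together with `a ↦ â_i`; and `ξ_ij` is `ψ_rij` at
`s_a(x)`. Naturality of `ξ` is `Fib.hat_naturality`, and its compatibility with `ψ` is the cocycle
condition for `(r, i, j, k)`.

For smoothness, every bundle is tested on local sections: all the operations preserve smooth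
sections, and by equivariance a bundle map is determined by its effect on one section. -/

/-! ### Disjoint unions of manifolds. -/

section SigmaManifold

open OpenPartialHomeomorph Topology

variable {ι : Type*} {H : Type*} [TopologicalSpace H] {X : ι → Type*}
  [∀ i, TopologicalSpace (X i)] [∀ i, ChartedSpace H (X i)]

/-- The disjoint union of a family of charted spaces. -/
@[reducible]
noncomputable def sigmaChartedSpace [Nonempty H] : ChartedSpace H (Σ i, X i) where
  atlas := {e | ∃ (i : ι) (f : OpenPartialHomeomorph (X i) H), f ∈ atlas H (X i) ∧
    e = f.lift_openEmbedding IsOpenEmbedding.sigmaMk}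
  chartAt p := (chartAt H p.2).lift_openEmbedding IsOpenEmbedding.sigmaMk
  mem_chart_source p := ⟨p.2, mem_chart_source H p.2, rfl⟩
  chart_mem_atlas p := ⟨p.1, _, chart_mem_atlas H p.2, rfl⟩

attribute [local instance] sigmaChartedSpace

variable {E : Type*} [NormedAddCommGroup E] [NormedSpace ℝ E] {I : ModelWithCorners ℝ E H}

theorem isManifold_sigma [Nonempty H] {n : WithTop ℕ∞} [∀ i, IsManifold I n (X i)] :
    IsManifold I n (Σ i, X i) := by
  have : HasGroupoid (Σ i, X i) (contDiffGroupoid n I) := by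
    refine ⟨?_⟩
    rintro _ _ ⟨i, f, hf, rfl⟩ ⟨j, g, hg, rfl⟩
    by_cases hij : i = j
    · subst hij
      rw [lift_openEmbedding_trans]
      exact HasGroupoid.compatible hf hg
    -- Charts of different summands do not overlap.
    · apply ContDiffGroupoid.mem_of_source_eq_empty
      ext x
      refine ⟨?_, fun hx => hx.elim⟩
      rintro ⟨-, y, -, hy⟩
      exact hij (congrArg Sigma.fst hy).symm
  exact { this with }

variable {E' : Type*} [NormedAddCommGroup E'] [NormedSpace ℝ E'] {H' : Type*}
  [TopologicalSpace H'] {J : ModelWithCorners ℝ E' H'} {N : Type*} [TopologicalSpace N]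
  [ChartedSpace H' N]

theorem contMDiff_sigmaMk [Nonempty H] {n : WithTop ℕ∞} (i : ι) :
    ContMDiff I I n (Sigma.mk i : X i → Σ i, X i) := by
  intro x
  rw [contMDiffAt_iff]
  refine ⟨continuous_sigmaMk.continuousAt, ?_⟩
  apply contDiffWithinAt_id.congr_of_eventuallyEq; swap
  · change I ((chartAt H x).lift_openEmbedding IsOpenEmbedding.sigmaMk ⟨i, _⟩) = _
    erw [lift_openEmbedding_apply]
    simp
  set C := chartAt H x with hC
  have : I.symm ⁻¹' C.target ∩ Set.range I ∈ 𝓝[Set.range I] (extChartAt I x) x := by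
    rw [← I.image_eq (chartAt H x).target]
    exact (chartAt H x).extend_image_target_mem_nhds (mem_chart_source _ x)
  filter_upwards [this] with y hy
  change I ((chartAt H x).lift_openEmbedding IsOpenEmbedding.sigmaMk ⟨i, _⟩) = _
  erw [lift_openEmbedding_apply]
  simp [← hC, C.right_inv hy.1, I.right_inv hy.2]

theorem contMDiff_sigma [Nonempty H] {n : WithTop ℕ∞} {f : (Σ i, X i) → N}
    (h : ∀ i, ContMDiff I J n fun x : X i => f ⟨i, x⟩) : ContMDiff I J n f := by
  rintro ⟨i, x⟩
  rw [contMDiffAt_iff, continuousAt_def]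
  have hx := h i x
  rw [contMDiffAt_iff] at hx
  refine ⟨?_, ?_⟩
  · exact (continuous_sigma fun i => (h i).continuous).continuousAt
  · have h2 := hx.2
    have e : extChartAt I (⟨i, x⟩ : Σ i, X i) ⟨i, x⟩ = extChartAt I x x := by
      change I ((chartAt H x).lift_openEmbedding IsOpenEmbedding.sigmaMk ⟨i, _⟩) = _
      erw [lift_openEmbedding_apply]
      rfl
    rw [e]
    exact h2

end SigmaManifold

/-- A disjoint union of metric spaces is again metrizable, and metrizable spaces are paracompact. -/
theorem paracompactSpace_sigma_of_metrizable {ι : Type*} {X : ι → Type*}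
    [∀ i, TopologicalSpace (X i)] [∀ i, TopologicalSpace.MetrizableSpace (X i)] :
    ParacompactSpace (Σ i, X i) := by
  let := fun i => TopologicalSpace.metrizableSpaceMetric (X i)
  let : MetricSpace (Σ i, X i) := Metric.Sigma.metricSpace
  infer_instance

theorem metrizableSpace_of_le_chartAt_source {H M : Type*} [TopologicalSpace H]
    [TopologicalSpace.MetrizableSpace H] [TopologicalSpace M] [ChartedSpace H M] {W : Opens M}
    {a : M} (h : (W : Set M) ⊆ (chartAt H a).source) : TopologicalSpace.MetrizableSpace W := by
  have := ((chartAt H a).isOpenEmbedding_restrict).isEmbedding.comp (Topology.IsEmbedding.inclusion h)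
  exact this.metrizableSpace

/-! ### Smooth functions on open subsets, pulled back along maps to the ambient manifold. -/

section Extension

variable {E : Type*} [NormedAddCommGroup E] [NormedSpace ℝ E] {H : Type*} [TopologicalSpace H]
  {I : ModelWithCorners ℝ E H} {M : Type*} [TopologicalSpace M] [ChartedSpace H M]
  {E' : Type*} [NormedAddCommGroup E'] [NormedSpace ℝ E'] {H' : Type*}
  [TopologicalSpace H'] {J : ModelWithCorners ℝ E' H'} {Z : Type*} [TopologicalSpace Z]
  [ChartedSpace H' Z] {E'' : Type*} [NormedAddCommGroup E''] [NormedSpace ℝ E''] {H'' : Type*}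
  [TopologicalSpace H''] {K : ModelWithCorners ℝ E'' H''} {Y : Type*} [TopologicalSpace Y]
  [ChartedSpace H'' Y]

theorem ContMDiffAt.contMDiffWithinAt_comp_opens {N : Opens M} {k : N → Y} {n : N}
    (hk : ContMDiffAt I K ∞ k n) {q : Z → M} {z : Z} {s : Set Z}
    (hq : ContMDiffWithinAt J I ∞ q s z) (hz : q z = n) (hs : z ∈ s) {f : Z → Y}
    (hf : ∀ᶠ z' in 𝓝[s] z, ∀ h : q z' ∈ N, f z' = k ⟨q z', h⟩) :
    ContMDiffWithinAt J K ∞ f s z := by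
  classical
  -- Corestriction of `q` to `N`; the value `n` off `q⁻¹(N)` is harmless because `q⁻¹(N)` is a
  -- neighbourhood of `z` within `s`.
  let r : Z → N := fun z' => if h : q z' ∈ N then ⟨q z', h⟩ else n
  have hN : ∀ᶠ z' in 𝓝[s] z, q z' ∈ N := by
    have : Filter.Tendsto q (𝓝[s] z) (𝓝 (q z)) := hq.continuousWithinAt
    exact this (N.isOpen.mem_nhds (hz ▸ n.2))
  have hr : ContMDiffWithinAt J I ∞ r s z := by
    rw [← ContMDiffWithinAt.subtypeVal_comp_iff]
    refine hq.congr_of_eventuallyEq_of_mem ?_ hs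
    filter_upwards [hN] with z' h
    simp [r, h]
  have hrz : r z = n := by
    ext
    simp [r, hz]
  rw [← hrz] at hk
  refine (hk.comp_contMDiffWithinAt z hr).congr_of_eventuallyEq_of_mem ?_ hs
  filter_upwards [hf, hN] with z' h h'
  simp [h h', r, h']

/-- Extension by `1` keeps the function invertible. It turns a ratio computed along local sections
over `N` into the globally defined `g` that smoothness of bundle maps asks for. -/
theorem ContMDiffAt.exists_units_extension {N : Opens M} {k : N → ℂˣ} {n : N}
    (hk : ContMDiffAt I 𝓘(ℝ, ℂ) ∞ (fun x => (k x : ℂ)) n) {q : Z → M} {z : Z} (s : Set Z)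
    (hq : ContMDiffWithinAt J I ∞ q s z) (hz : q z = n) (hs : z ∈ s) :
    ∃ g : Z → ℂˣ, ContMDiffWithinAt J 𝓘(ℝ, ℂ) ∞ (fun x => (g x : ℂ)) s z ∧
      ∀ z' (h : q z' ∈ N), g z' = k ⟨q z', h⟩ := by
  classical
  refine ⟨fun z' => if h : q z' ∈ N then k ⟨q z', h⟩ else 1, ?_, fun z' h => dif_pos h⟩
  refine hk.contMDiffWithinAt_comp_opens hq hz hs (.of_forall fun z' h => ?_)
  simp [h]

end Extension

/-! ### Smooth sections of pulled back bundles, and operations on them. -/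

section SmoothSections

variable {E : Type*} [NormedAddCommGroup E] [NormedSpace ℝ E] {N : Type*} [TopologicalSpace N]
  [ChartedSpace E N]

theorem ContMDiffAt.units_mul {k l : N → ℂˣ} {n : N}
    (hk : ContMDiffAt 𝓘(ℝ, E) 𝓘(ℝ, ℂ) ∞ (fun x => (k x : ℂ)) n)
    (hl : ContMDiffAt 𝓘(ℝ, E) 𝓘(ℝ, ℂ) ∞ (fun x => (l x : ℂ)) n) :
    ContMDiffAt 𝓘(ℝ, E) 𝓘(ℝ, ℂ) ∞ (fun x => ((k x * l x : ℂˣ) : ℂ)) n := by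
  simp only [Units.val_mul]
  exact BundleGerbe.contMDiffWithinAt_mul_complex hk hl

theorem ContMDiffAt.units_div {k l : N → ℂˣ} {n : N}
    (hk : ContMDiffAt 𝓘(ℝ, E) 𝓘(ℝ, ℂ) ∞ (fun x => (k x : ℂ)) n)
    (hl : ContMDiffAt 𝓘(ℝ, E) 𝓘(ℝ, ℂ) ∞ (fun x => (l x : ℂ)) n) :
    ContMDiffAt 𝓘(ℝ, E) 𝓘(ℝ, ℂ) ∞ (fun x => ((k x / l x : ℂˣ) : ℂ)) n := by
  have hinv : ContMDiffAt 𝓘(ℝ, E) 𝓘(ℝ, ℂ) ∞ (fun x => (l x : ℂ)⁻¹) n :=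
    ((contDiffAt_inv ℝ (l n).ne_zero).contMDiffAt).comp n hl
  simp only [div_eq_mul_inv, Units.val_mul, Units.val_inv_eq_inv_val]
  exact BundleGerbe.contMDiffWithinAt_mul_complex hk hinv

namespace PrincipalBundle

variable {F : Type*} [NormedAddCommGroup F] [NormedSpace ℝ F]
  {H : Type*} [TopologicalSpace H] {J : ModelWithCorners ℝ F H}
  {Z : Type u} [TopologicalSpace Z] [ChartedSpace H Z] {R : Set Z} (P : PrincipalBundle J Z R)

theorem smul_right_inj {z : Z} {a : P.fib z} {c d : ℂˣ} : c • a = d • a ↔ c = d :=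
  ⟨fun h => (P.existsUnique_smul a (d • a)).unique h rfl, fun h => h ▸ rfl⟩

variable (E) in
/-- Smoothness at `n₀` of a section `t` of the pullback `f⁻¹P` of `P` along `f : N → Z`. -/
def SmoothAt {f : N → Z} (t : ∀ n, P.fib (f n)) (n₀ : N) : Prop :=
  ∀ τ ∈ P.atlas, f n₀ ∈ τ.1 →
    ContMDiffAt 𝓘(ℝ, E) 𝓘(ℝ, ℂ) ∞ (fun n => (τ.2 _ (t n) : ℂ)) n₀

/-- Take the section that is `1` in one trivialisation, and arbitrary outside its domain. In any
other trivialisation it is the transition function composed with `f`. -/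
theorem exists_smoothAt {f : N → Z} (hR : ∀ n, f n ∈ R) {n₀ : N}
    (hf : ContMDiffAt 𝓘(ℝ, E) J ∞ f n₀) : ∃ t : ∀ n, P.fib (f n), P.SmoothAt E t n₀ := by
  obtain ⟨τ, hτ, hτ₀⟩ := P.exists_mem_atlas _ (hR n₀)
  have hn : ∀ n, ∃ a : P.fib (f n), f n ∈ τ.1 → τ.2 _ a = 1 := fun n => by
    obtain ⟨a⟩ := (P.nonempty_fib_iff _).2 (hR n)
    refine ⟨(τ.2 _ a)⁻¹ • a, fun h => ?_⟩
    rw [P.equivariant τ hτ _ h, inv_mul_cancel]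
  choose t ht using hn
  refine ⟨t, fun σ hσ hσ₀ => ?_⟩
  obtain ⟨g, hg, hg'⟩ := P.smooth_transition τ hτ σ hσ _ (hR n₀) hτ₀ hσ₀
  have hgf : ContMDiffAt 𝓘(ℝ, E) 𝓘(ℝ, ℂ) ∞ (fun n => (g (f n) : ℂ)) n₀ :=
    contMDiffWithinAt_univ.1 (hg.comp n₀ (contMDiffWithinAt_univ.2 hf) fun n _ => hR n)
  refine hgf.congr_of_eventuallyEq ?_
  have ht' : Filter.Tendsto f (𝓝 n₀) (𝓝[R] (f n₀)) :=
    tendsto_nhdsWithin_iff.2 ⟨hf.continuousAt, .of_forall hR⟩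
  filter_upwards [ht'.eventually hg', hf.continuousAt.preimage_mem_nhds (τ.1.isOpen.mem_nhds hτ₀)]
    with n h h'
  rw [h, ht n h', mul_one]

variable {P}

theorem SmoothAt.smul {f : N → Z} {t : ∀ n, P.fib (f n)} {n₀ : N} (ht : P.SmoothAt E t n₀)
    (hf : ContinuousAt f n₀) {c : N → ℂˣ}
    (hc : ContMDiffAt 𝓘(ℝ, E) 𝓘(ℝ, ℂ) ∞ (fun x => (c x : ℂ)) n₀) :
    P.SmoothAt E (fun n => c n • t n) n₀ := fun τ hτ h₀ => by
  refine (hc.units_mul (ht τ hτ h₀)).congr_of_eventuallyEq ?_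
  filter_upwards [hf.preimage_mem_nhds (τ.1.isOpen.mem_nhds h₀)] with n hn
  rw [P.equivariant τ hτ _ hn]

/-- In a trivialisation, `c` is the quotient of the components of `t'` and `t`. -/
theorem SmoothAt.contMDiffAt_of_smul_eq {f : N → Z} {t t' : ∀ n, P.fib (f n)} {n₀ : N}
    (ht : P.SmoothAt E t n₀) (ht' : P.SmoothAt E t' n₀) (hf : ContinuousAt f n₀) (hR : f n₀ ∈ R)
    {c : N → ℂˣ} (hc : ∀ n, c n • t n = t' n) :
    ContMDiffAt 𝓘(ℝ, E) 𝓘(ℝ, ℂ) ∞ (fun x => (c x : ℂ)) n₀ := by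
  obtain ⟨τ, hτ, hτ₀⟩ := P.exists_mem_atlas _ hR
  refine ((ht' τ hτ hτ₀).units_div (ht τ hτ hτ₀)).congr_of_eventuallyEq ?_
  filter_upwards [hf.preimage_mem_nhds (τ.1.isOpen.mem_nhds hτ₀)] with n hn
  rw [← hc, P.equivariant τ hτ _ hn, mul_div_cancel_right]

end PrincipalBundle

/-! ### Division in a bundle gerbe, and smoothness of its operations on sections. -/

namespace BundleGerbe

variable {E₀ : Type v} [NormedAddCommGroup E₀] [NormedSpace ℝ E₀]
  {M : Type u} [TopologicalSpace M] [ChartedSpace E₀ M] {U U' : Opens M}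
  {Q : BundleGerbe (E := E₀) U} {Q' : BundleGerbe (E := E₀) U'}

theorem π_eq {x y : Q.X} (a : Q.P.fib (x, y)) : Q.π x = Q.π y :=
  (Q.P.nonempty_fib_iff (x, y)).1 ⟨a⟩

theorem nonempty_fib {x y : Q.X} (h : Q.π x = Q.π y) : Nonempty (Q.P.fib (x, y)) :=
  (Q.P.nonempty_fib_iff (x, y)).2 h

theorem π_mem (x : Q.X) : Q.π x ∈ U := by
  have : Q.π x ∈ Set.range Q.π := ⟨x, rfl⟩
  rw [Q.range_π] at this
  exact this

/-- Right multiplication by `a` is an equivariant map between `ℂˣ`-torsors, hence bijective. -/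
theorem existsUnique_mul_eq {x y z : Q.X} (c : Q.P.fib (x, z)) (a : Q.P.fib (x, y)) :
    ∃! b : Q.P.fib (y, z), Q.mul b a = c := by
  obtain ⟨b⟩ := nonempty_fib ((π_eq a).symm.trans (π_eq c))
  obtain ⟨k, hk, -⟩ := Q.P.existsUnique_smul (Q.mul b a) c
  refine ⟨k • b, (Q.smul_mul _ _ _).trans hk, fun b' hb' => ?_⟩
  obtain ⟨l, rfl, -⟩ := Q.P.existsUnique_smul b b'
  simp only [Q.smul_mul] at hb'
  rw [← hk, Q.P.smul_right_inj] at hb'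
  rw [hb']

/-- The right quotient `c a⁻¹` of elements `c` and `a` of a bundle gerbe. -/
noncomputable def rdiv {x y z : Q.X} (c : Q.P.fib (x, z)) (a : Q.P.fib (x, y)) : Q.P.fib (y, z) :=
  (existsUnique_mul_eq c a).choose

theorem rdiv_mul {x y z : Q.X} (c : Q.P.fib (x, z)) (a : Q.P.fib (x, y)) :
    Q.mul (rdiv c a) a = c :=
  (existsUnique_mul_eq c a).choose_spec.1

theorem mul_right_cancel {x y z : Q.X} {b b' : Q.P.fib (y, z)} (a : Q.P.fib (x, y))
    (h : Q.mul b a = Q.mul b' a) : b = b' :=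
  (existsUnique_mul_eq _ a).unique h rfl

theorem rdiv_smul {x y z : Q.X} (k : ℂˣ) (c : Q.P.fib (x, z)) (a : Q.P.fib (x, y)) :
    rdiv (k • c) a = k • rdiv c a :=
  mul_right_cancel a (by rw [rdiv_mul, Q.smul_mul, rdiv_mul])

theorem smoothAt_mul {f g h : N → Q.X} {n₀ : N}
    (hf : ContMDiffAt 𝓘(ℝ, E) 𝓘(ℝ, Q.V) ∞ f n₀) (hg : ContMDiffAt 𝓘(ℝ, E) 𝓘(ℝ, Q.V) ∞ g n₀)
    (hh : ContMDiffAt 𝓘(ℝ, E) 𝓘(ℝ, Q.V) ∞ h n₀)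
    {s : ∀ n, Q.P.fib (g n, h n)} {t : ∀ n, Q.P.fib (f n, g n)}
    (hs : Q.P.SmoothAt E (f := fun n => (g n, h n)) s n₀)
    (ht : Q.P.SmoothAt E (f := fun n => (f n, g n)) t n₀) :
    Q.P.SmoothAt E (f := fun n => (f n, h n)) (fun n => Q.mul (s n) (t n)) n₀ := by
  intro ρ hρ h₀
  have hfg : ∀ n, Q.π (f n) = Q.π (g n) := fun n => π_eq (t n)
  have hgh : ∀ n, Q.π (g n) = Q.π (h n) := fun n => π_eq (s n)
  obtain ⟨σ, hσ, hσ₀⟩ := Q.P.exists_mem_atlas (f n₀, g n₀) (hfg n₀)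
  obtain ⟨τ, hτ, hτ₀⟩ := Q.P.exists_mem_atlas (g n₀, h n₀) (hgh n₀)
  obtain ⟨l, hl, hl'⟩ := Q.smooth_mul _ _ _ (hfg n₀) (hgh n₀) τ hτ σ hσ ρ hρ hτ₀ hσ₀ h₀
  have hc : ContMDiffAt 𝓘(ℝ, E) (𝓘(ℝ, Q.V).prod (𝓘(ℝ, Q.V).prod 𝓘(ℝ, Q.V))) ∞
      (fun n => (f n, g n, h n)) n₀ := hf.prodMk (hg.prodMk hh)
  have hl₀ : ContMDiffAt 𝓘(ℝ, E) 𝓘(ℝ, ℂ) ∞ (fun n => (l (f n, g n, h n) : ℂ)) n₀ :=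
    contMDiffWithinAt_univ.1 (ContMDiffWithinAt.comp (g := fun p => (l p : ℂ)) n₀ hl
      (contMDiffWithinAt_univ.2 hc) fun n _ => ⟨hfg n, hgh n⟩)
  have htd : Filter.Tendsto (fun n => (f n, g n, h n)) (𝓝 n₀)
      (𝓝[{p | Q.π p.1 = Q.π p.2.1 ∧ Q.π p.2.1 = Q.π p.2.2}] (f n₀, g n₀, h n₀)) :=
    tendsto_nhdsWithin_iff.2 ⟨hc.continuousAt, .of_forall fun n => ⟨hfg n, hgh n⟩⟩
  refine (hl₀.units_mul ((hs τ hτ hτ₀).units_mul (ht σ hσ hσ₀))).congr_of_eventuallyEq ?_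
  filter_upwards [htd.eventually hl'] with n hn
  rw [hn]

/-- Compare the quotient with a smooth section `r`: if `s t⁻¹ = c r`, then `c (r t) = s`, so `c` is
a ratio of smooth sections. -/
theorem smoothAt_rdiv {f g h : N → Q.X} {n₀ : N}
    (hf : ContMDiffAt 𝓘(ℝ, E) 𝓘(ℝ, Q.V) ∞ f n₀) (hg : ContMDiffAt 𝓘(ℝ, E) 𝓘(ℝ, Q.V) ∞ g n₀)
    (hh : ContMDiffAt 𝓘(ℝ, E) 𝓘(ℝ, Q.V) ∞ h n₀)
    {s : ∀ n, Q.P.fib (f n, h n)} {t : ∀ n, Q.P.fib (f n, g n)}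
    (hs : Q.P.SmoothAt E (f := fun n => (f n, h n)) s n₀)
    (ht : Q.P.SmoothAt E (f := fun n => (f n, g n)) t n₀) :
    Q.P.SmoothAt E (f := fun n => (g n, h n)) (fun n => rdiv (s n) (t n)) n₀ := by
  obtain ⟨r, hr⟩ := Q.P.exists_smoothAt (f := fun n => (g n, h n))
    (fun n => (π_eq (t n)).symm.trans (π_eq (s n))) (hg.prodMk hh)
  choose c hc hc' using fun n => Q.P.existsUnique_smul (r n) (rdiv (s n) (t n))
  simp only [← hc]
  refine hr.smul (hg.prodMk hh).continuousAt ?_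
  refine (smoothAt_mul hf hg hh hr ht).contMDiffAt_of_smul_eq hs (hf.prodMk hh).continuousAt
    (π_eq (s n₀)) fun n => ?_
  rw [← Q.smul_mul, hc, rdiv_mul]

theorem Hom.smoothAt_fhat {V : Opens M} (k : Hom V Q Q') {f g : N → Q.restr V} {n₀ : N}
    (hf : ContMDiffAt 𝓘(ℝ, E) 𝓘(ℝ, Q.V) ∞ f n₀) (hg : ContMDiffAt 𝓘(ℝ, E) 𝓘(ℝ, Q.V) ∞ g n₀)
    {t : ∀ n, Q.P.fib (f n, g n)} (ht : Q.P.SmoothAt E (f := fun n => ((f n : Q.X), (g n : Q.X))) t n₀) :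
    Q'.P.SmoothAt E (f := fun n => (k.f (f n), k.f (g n))) (fun n => k.fhat (t n)) n₀ := by
  intro ρ hρ h₀
  have hfg : ∀ n, Q.π (f n) = Q.π (g n) := fun n => π_eq (t n)
  obtain ⟨σ, hσ, hσ₀⟩ := Q.P.exists_mem_atlas (f n₀, g n₀) (hfg n₀)
  obtain ⟨l, hl, hl'⟩ := k.smooth_fhat (f n₀) (g n₀) (hfg n₀) σ hσ ρ hρ hσ₀ h₀
  have hc : ContMDiffAt 𝓘(ℝ, E) (𝓘(ℝ, Q.V).prod 𝓘(ℝ, Q.V)) ∞ (fun n => (f n, g n)) n₀ :=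
    hf.prodMk hg
  have hl₀ : ContMDiffAt 𝓘(ℝ, E) 𝓘(ℝ, ℂ) ∞ (fun n => (l (f n, g n) : ℂ)) n₀ :=
    contMDiffWithinAt_univ.1 (ContMDiffWithinAt.comp (g := fun p => (l p : ℂ)) n₀ hl
      (contMDiffWithinAt_univ.2 hc) fun n _ => hfg n)
  have htd : Filter.Tendsto (fun n => (f n, g n)) (𝓝 n₀)
      (𝓝[{p | Q.π p.1 = Q.π p.2}] (f n₀, g n₀)) :=
    tendsto_nhdsWithin_iff.2 ⟨hc.continuousAt, .of_forall hfg⟩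
  refine (hl₀.units_mul (ht σ hσ hσ₀)).congr_of_eventuallyEq ?_
  filter_upwards [htd.eventually hl'] with n hn
  rw [hn]

theorem Trans.smoothAt_app {V : Opens M} {k l : Hom V Q Q'} (θ : Trans k l) {f : N → Q.restr V}
    {n₀ : N} (hf : ContMDiffAt 𝓘(ℝ, E) 𝓘(ℝ, Q.V) ∞ f n₀) :
    Q'.P.SmoothAt E (f := fun n => (k.f (f n), l.f (f n))) (fun n => θ.app (f n)) n₀ :=
  fun τ hτ h₀ =>
    ContMDiffAt.comp (g := fun x => (τ.2 _ (θ.app x) : ℂ)) n₀ (θ.smooth_app _ τ hτ h₀) hf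

end BundleGerbe

end SmoothSections

/-! ### Algebra of the glued bundle: fibres, images in the `Q_k`, product. -/

namespace TwoDescentData

open BundleGerbe

variable {E : Type v} [NormedAddCommGroup E] [NormedSpace ℝ E]
  {M : Type u} [TopologicalSpace M] [ChartedSpace E M] {ι : Type*} {U : ι → Opens M}
  (D : TwoDescentData (E := E) U) {i j k l : ι}

/-- The image under `φ_ij` of a point of `Q_i`. -/
def lift (z : (D.Q i).X) (j : ι) (hj : (D.Q i).π z ∈ U j) : (D.Q j).X :=
  (D.φ i j).f ⟨z, ⟨π_mem z, hj⟩⟩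

theorem π_lift (z : (D.Q i).X) (hj : (D.Q i).π z ∈ U j) :
    (D.Q j).π (D.lift z j hj) = (D.Q i).π z :=
  (D.φ i j).π_f _

theorem π_lift_mem {z : (D.Q i).X} (hj : (D.Q i).π z ∈ U j) (hk : (D.Q i).π z ∈ U k) :
    (D.Q j).π (D.lift z j hj) ∈ U k :=
  (D.π_lift z hj).symm ▸ hk

/-- The image under `φ_ij` of an element of the `ℂˣ`-bundle of `Q_i`. -/
def map {z w : (D.Q i).X} (a : (D.Q i).P.fib (z, w)) (j : ι) (hz : (D.Q i).π z ∈ U j)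
    (hw : (D.Q i).π w ∈ U j) : (D.Q j).P.fib (D.lift z j hz, D.lift w j hw) :=
  (D.φ i j).fhat (x := ⟨z, ⟨π_mem z, hz⟩⟩) (y := ⟨w, ⟨π_mem w, hw⟩⟩) a

theorem map_smul {z w : (D.Q i).X} (c : ℂˣ) (a : (D.Q i).P.fib (z, w)) (hz : (D.Q i).π z ∈ U j)
    (hw : (D.Q i).π w ∈ U j) : D.map (c • a) j hz hw = c • D.map a j hz hw :=
  (D.φ i j).fhat_smul (x := ⟨z, _⟩) (y := ⟨w, _⟩) c a

theorem map_mul {z w t : (D.Q i).X} (b : (D.Q i).P.fib (w, t)) (a : (D.Q i).P.fib (z, w))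
    (hz : (D.Q i).π z ∈ U j) (hw : (D.Q i).π w ∈ U j) (ht : (D.Q i).π t ∈ U j) :
    D.map ((D.Q i).mul b a) j hz ht = (D.Q j).mul (D.map b j hw ht) (D.map a j hz hw) :=
  (D.φ i j).fhat_mul (x := ⟨z, _⟩) (y := ⟨w, _⟩) (z := ⟨t, _⟩) b a

/-- The value of `ψ_ijk` at a point of `Q_i`. -/
def coh (z : (D.Q i).X) (j k : ι) (hj : (D.Q i).π z ∈ U j) (hk : (D.Q i).π z ∈ U k) :
    (D.Q k).P.fib (D.lift (D.lift z j hj) k (D.π_lift_mem hj hk), D.lift z k hk) :=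
  (D.ψ i j k).app ⟨z, ⟨⟨π_mem z, hj⟩, hk⟩⟩

theorem coh_cocycle (z : (D.Q i).X) (hj : (D.Q i).π z ∈ U j) (hk : (D.Q i).π z ∈ U k)
    (hl : (D.Q i).π z ∈ U l) :
    (D.Q l).mul (D.coh z k l hk hl)
        (D.map (D.coh z j k hj hk) l (D.π_lift_mem _ (D.π_lift_mem hj hl)) (D.π_lift_mem hk hl)) =
      (D.Q l).mul (D.coh z j l hj hl)
        (D.coh (D.lift z j hj) k l (D.π_lift_mem hj hk) (D.π_lift_mem hj hl)) :=
  congrArg (fun θ => θ.app ⟨z, ⟨⟨⟨π_mem z, hj⟩, hk⟩, hl⟩⟩) (D.cocycle i j k l)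

theorem coh_naturality {z w : (D.Q i).X} (a : (D.Q i).P.fib (z, w))
    (hzj : (D.Q i).π z ∈ U j) (hwj : (D.Q i).π w ∈ U j)
    (hzk : (D.Q i).π z ∈ U k) (hwk : (D.Q i).π w ∈ U k) :
    (D.Q k).mul (D.coh w j k hwj hwk)
        (D.map (D.map a j hzj hwj) k (D.π_lift_mem hzj hzk) (D.π_lift_mem hwj hwk)) =
      (D.Q k).mul (D.map a k hzk hwk) (D.coh z j k hzj hzk) :=
  (D.ψ i j k).naturality (x := ⟨z, ⟨⟨π_mem z, hzj⟩, hzk⟩⟩) (y := ⟨w, ⟨⟨π_mem w, hwj⟩, hwk⟩⟩) a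

/-- The fibre over `(z, w)` of the glued `ℂˣ`-bundle, for `z` in `Q_i` and `w` in `Q_j`. -/
@[ext]
structure Fib (z : (D.Q i).X) (w : (D.Q j).X) : Type u where
  π_eq : (D.Q i).π z = (D.Q j).π w
  val : (D.Q j).P.fib (D.lift z j (π_eq ▸ π_mem w), w)

namespace Fib

variable {D} {z : (D.Q i).X} {w : (D.Q j).X} {t : (D.Q k).X}

instance : MulAction ℂˣ (D.Fib z w) where
  smul c a := ⟨a.π_eq, c • a.val⟩
  one_smul a := Fib.ext (one_smul _ a.val)
  mul_smul c d a := Fib.ext (mul_smul c d a.val)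

theorem val_smul (c : ℂˣ) (a : D.Fib z w) : (c • a).val = c • a.val := rfl

theorem nonempty_iff : Nonempty (D.Fib z w) ↔ (D.Q i).π z = (D.Q j).π w := by
  refine ⟨fun ⟨a⟩ => a.π_eq, fun h => ?_⟩
  obtain ⟨a⟩ := nonempty_fib ((D.π_lift z (h ▸ π_mem w)).trans h)
  exact ⟨⟨h, a⟩⟩

theorem existsUnique_smul (a b : D.Fib z w) : ∃! c : ℂˣ, c • a = b := by
  obtain ⟨c, hc, hc'⟩ := (D.Q j).P.existsUnique_smul a.val b.val
  exact ⟨c, Fib.ext hc, fun d hd => hc' d (Fib.ext_iff.1 hd)⟩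

/-- The image of an element of the glued `ℂˣ`-bundle in `Q_k`. -/
noncomputable def hat (a : D.Fib z w) (k : ι) (hz : (D.Q i).π z ∈ U k) (hw : (D.Q j).π w ∈ U k) :
    (D.Q k).P.fib (D.lift z k hz, D.lift w k hw) :=
  -- `φ_jk(a)` starts at `φ_jk(φ_ij z)`; dividing by `ψ_ijk(z)` moves its source to `φ_ik z`.
  rdiv (D.map a.val k (D.π_lift_mem _ hz) hw) (D.coh z j k (a.π_eq ▸ π_mem w) hz)

theorem hat_mul_coh (a : D.Fib z w) (hz : (D.Q i).π z ∈ U k) (hw : (D.Q j).π w ∈ U k) :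
    (D.Q k).mul (a.hat k hz hw) (D.coh z j k (a.π_eq ▸ π_mem w) hz) =
      D.map a.val k (D.π_lift_mem _ hz) hw :=
  rdiv_mul _ _

theorem hat_smul (c : ℂˣ) (a : D.Fib z w) (hz : (D.Q i).π z ∈ U k) (hw : (D.Q j).π w ∈ U k) :
    (c • a).hat k hz hw = c • a.hat k hz hw := by
  simp only [hat, val_smul, map_smul, rdiv_smul]

/-- Multiply both sides on the right by `φ_kl(ψ_ijk(z))`. The left side becomes `φ_jl(a) ψ_jkl(φ_ij
z)` by naturality of `ψ_jkl`, and the right side becomes the same by the cocycle condition at `z`.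
-/
theorem hat_naturality (a : D.Fib z w) (hzk : (D.Q i).π z ∈ U k) (hwk : (D.Q j).π w ∈ U k)
    (hzl : (D.Q i).π z ∈ U l) (hwl : (D.Q j).π w ∈ U l) :
    (D.Q l).mul (D.coh w k l hwk hwl)
        (D.map (a.hat k hzk hwk) l (D.π_lift_mem hzk hzl) (D.π_lift_mem hwk hwl)) =
      (D.Q l).mul (a.hat l hzl hwl) (D.coh z k l hzk hzl) := by
  have hzj : (D.Q i).π z ∈ U j := a.π_eq ▸ π_mem w
  have hzk' := D.π_lift_mem hzj hzk
  have hzl' := D.π_lift_mem hzj hzl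
  apply mul_right_cancel
    (D.map (D.coh z j k hzj hzk) l (D.π_lift_mem hzk' hzl') (D.π_lift_mem hzk hzl))
  rw [← (D.Q l).mul_assoc, ← D.map_mul, hat_mul_coh, coh_naturality, ← (D.Q l).mul_assoc,
    coh_cocycle, (D.Q l).mul_assoc, hat_mul_coh]

/-- The product of the glued bundle gerbe. -/
noncomputable def mul (b : D.Fib w t) (a : D.Fib z w) : D.Fib z t :=
  ⟨a.π_eq.trans b.π_eq, (D.Q k).mul b.val
    (a.hat k ((a.π_eq.trans b.π_eq) ▸ π_mem t) (b.π_eq ▸ π_mem t))⟩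

theorem val_mul (b : D.Fib w t) (a : D.Fib z w) : (b.mul a).val = (D.Q k).mul b.val
    (a.hat k ((a.π_eq.trans b.π_eq) ▸ π_mem t) (b.π_eq ▸ π_mem t)) := rfl

/-- After right multiplication by `ψ_ikl(z)`, the left side is `φ_kl(b) φ_kl(â_k) = b̂_l ψ_jkl(w)
φ_kl(â_k)`, and `hat_naturality` moves `ψ` past `â`. -/
theorem hat_mul (b : D.Fib w t) (a : D.Fib z w) (hz : (D.Q i).π z ∈ U l)
    (hw : (D.Q j).π w ∈ U l) (ht : (D.Q k).π t ∈ U l) :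
    (b.mul a).hat l hz ht = (D.Q l).mul (b.hat l hw ht) (a.hat l hz hw) := by
  have hwk : (D.Q j).π w ∈ U k := b.π_eq ▸ π_mem t
  have hzk : (D.Q i).π z ∈ U k := a.π_eq ▸ hwk
  apply mul_right_cancel (D.coh z k l hzk hz)
  rw [hat_mul_coh, val_mul, D.map_mul _ _ _ (D.π_lift_mem hwk hw), ← hat_mul_coh,
    ← (D.Q l).mul_assoc, hat_naturality, (D.Q l).mul_assoc]

theorem smul_mul (c : ℂˣ) (b : D.Fib w t) (a : D.Fib z w) : (c • b).mul a = c • b.mul a :=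
  Fib.ext ((D.Q k).smul_mul c _ _)

theorem mul_smul (c : ℂˣ) (b : D.Fib w t) (a : D.Fib z w) : b.mul (c • a) = c • b.mul a :=
  Fib.ext (by rw [val_smul, val_mul, val_mul, hat_smul, (D.Q k).mul_smul])

theorem mul_assoc {s : (D.Q l).X} (c : D.Fib t s) (b : D.Fib w t) (a : D.Fib z w) :
    c.mul (b.mul a) = (c.mul b).mul a := by
  have hts : (D.Q k).π t ∈ U l := c.π_eq ▸ π_mem s
  have hws : (D.Q j).π w ∈ U l := b.π_eq ▸ hts
  apply Fib.ext
  rw [val_mul, val_mul, val_mul, hat_mul _ _ _ hws, (D.Q l).mul_assoc]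

end Fib

/-! ### Smoothness of the glued operations on sections. -/

section Smooth

variable {D} {E' : Type*} [NormedAddCommGroup E'] [NormedSpace ℝ E'] {N : Type*}
  [TopologicalSpace N] [ChartedSpace E' N] {n₀ : N}
  {z : N → (D.Q i).X} {w : N → (D.Q j).X} {t : N → (D.Q k).X}

theorem contMDiffAt_lift (hz : ContMDiffAt 𝓘(ℝ, E') 𝓘(ℝ, (D.Q i).V) ∞ z n₀)
    (hj : ∀ n, (D.Q i).π (z n) ∈ U j) :
    ContMDiffAt 𝓘(ℝ, E') 𝓘(ℝ, (D.Q j).V) ∞ (fun n => D.lift (z n) j (hj n)) n₀ :=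
  (D.φ i j).smooth_f.contMDiffAt.comp n₀
    ((ContMDiffAt.subtypeVal_comp_iff _ 
      (fun n => (⟨z n, ⟨π_mem (z n), hj n⟩⟩ : (D.Q i).restr (U i ⊓ U j))) n₀).1 hz)

theorem smoothAt_coh (hz : ContMDiffAt 𝓘(ℝ, E') 𝓘(ℝ, (D.Q i).V) ∞ z n₀)
    (hj : ∀ n, (D.Q i).π (z n) ∈ U j) (hk : ∀ n, (D.Q i).π (z n) ∈ U k) :
    (D.Q k).P.SmoothAt E' (f := fun n => (D.lift (D.lift (z n) j (hj n)) k
      (D.π_lift_mem (hj n) (hk n)), D.lift (z n) k (hk n)))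
      (fun n => D.coh (z n) j k (hj n) (hk n)) n₀ :=
  (D.ψ i j k).smoothAt_app (f := fun n => ⟨z n, ⟨⟨π_mem (z n), hj n⟩, hk n⟩⟩)
    ((ContMDiffAt.subtypeVal_comp_iff _ _ n₀).1 hz)

theorem smoothAt_map {z' : N → (D.Q i).X} (hz : ContMDiffAt 𝓘(ℝ, E') 𝓘(ℝ, (D.Q i).V) ∞ z n₀)
    (hz' : ContMDiffAt 𝓘(ℝ, E') 𝓘(ℝ, (D.Q i).V) ∞ z' n₀)
    (hj : ∀ n, (D.Q i).π (z n) ∈ U j) (hj' : ∀ n, (D.Q i).π (z' n) ∈ U j)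
    {a : ∀ n, (D.Q i).P.fib (z n, z' n)}
    (ha : (D.Q i).P.SmoothAt E' (f := fun n => (z n, z' n)) a n₀) :
    (D.Q j).P.SmoothAt E' (f := fun n => (D.lift (z n) j (hj n), D.lift (z' n) j (hj' n)))
      (fun n => D.map (a n) j (hj n) (hj' n)) n₀ :=
  (D.φ i j).smoothAt_fhat (f := fun n => ⟨z n, ⟨π_mem (z n), hj n⟩⟩)
    (g := fun n => ⟨z' n, ⟨π_mem (z' n), hj' n⟩⟩)
    ((ContMDiffAt.subtypeVal_comp_iff _ _ n₀).1 hz)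
    ((ContMDiffAt.subtypeVal_comp_iff _ _ n₀).1 hz') ha

/-- Smoothness at `n₀` of a section of the pullback of the glued `ℂˣ`-bundle along `(z, w)`. -/
def SmoothAt (a : ∀ n, D.Fib (z n) (w n)) (n₀ : N) : Prop :=
  (D.Q j).P.SmoothAt E' (f := fun n => (D.lift (z n) j ((a n).π_eq ▸ π_mem (w n)), w n))
    (fun n => (a n).val) n₀

theorem exists_smoothAt (hz : ContMDiffAt 𝓘(ℝ, E') 𝓘(ℝ, (D.Q i).V) ∞ z n₀)
    (hw : ContMDiffAt 𝓘(ℝ, E') 𝓘(ℝ, (D.Q j).V) ∞ w n₀)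
    (h : ∀ n, (D.Q i).π (z n) = (D.Q j).π (w n)) :
    ∃ a : ∀ n, D.Fib (z n) (w n), SmoothAt (E' := E') a n₀ := by
  have hj : ∀ n, (D.Q i).π (z n) ∈ U j := fun n => h n ▸ π_mem (w n)
  obtain ⟨t, ht⟩ := (D.Q j).P.exists_smoothAt (f := fun n => (D.lift (z n) j (hj n), w n))
    (fun n => (D.π_lift _ (hj n)).trans (h n)) ((contMDiffAt_lift hz hj).prodMk hw)
  exact ⟨fun n => ⟨h n, t n⟩, ht⟩

theorem SmoothAt.hat (hz : ContMDiffAt 𝓘(ℝ, E') 𝓘(ℝ, (D.Q i).V) ∞ z n₀)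
    (hw : ContMDiffAt 𝓘(ℝ, E') 𝓘(ℝ, (D.Q j).V) ∞ w n₀) {a : ∀ n, D.Fib (z n) (w n)}
    (ha : SmoothAt (E' := E') a n₀) (hzk : ∀ n, (D.Q i).π (z n) ∈ U k)
    (hwk : ∀ n, (D.Q j).π (w n) ∈ U k) :
    (D.Q k).P.SmoothAt E' (f := fun n => (D.lift (z n) k (hzk n), D.lift (w n) k (hwk n)))
      (fun n => (a n).hat k (hzk n) (hwk n)) n₀ :=
  have hj : ∀ n, (D.Q i).π (z n) ∈ U j := fun n => (a n).π_eq ▸ π_mem (w n)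
  have hl := contMDiffAt_lift hz hj
  smoothAt_rdiv (contMDiffAt_lift hl fun n => D.π_lift_mem (hj n) (hzk n))
    (contMDiffAt_lift hz hzk) (contMDiffAt_lift hw hwk)
    (smoothAt_map hl hw (fun n => D.π_lift_mem (hj n) (hzk n)) hwk ha) (smoothAt_coh hz hj hzk)

theorem SmoothAt.mul (hz : ContMDiffAt 𝓘(ℝ, E') 𝓘(ℝ, (D.Q i).V) ∞ z n₀)
    (hw : ContMDiffAt 𝓘(ℝ, E') 𝓘(ℝ, (D.Q j).V) ∞ w n₀)
    (ht : ContMDiffAt 𝓘(ℝ, E') 𝓘(ℝ, (D.Q k).V) ∞ t n₀)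
    {b : ∀ n, D.Fib (w n) (t n)} {a : ∀ n, D.Fib (z n) (w n)}
    (hb : SmoothAt (E' := E') b n₀) (ha : SmoothAt (E' := E') a n₀) :
    SmoothAt (E' := E') (fun n => (b n).mul (a n)) n₀ :=
  have hwk : ∀ n, (D.Q j).π (w n) ∈ U k := fun n => (b n).π_eq ▸ π_mem (t n)
  have hzk : ∀ n, (D.Q i).π (z n) ∈ U k := fun n => (a n).π_eq ▸ hwk n
  smoothAt_mul (contMDiffAt_lift hz hzk) (contMDiffAt_lift hw hwk) ht hb
    (SmoothAt.hat hz hw ha hzk hwk)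

end Smooth

end TwoDescentData

/-! ### Local sections, their disjoint union, and the atlas of the glued bundle. -/

namespace TwoDescentData

open BundleGerbe

/-- A family of smooth local sections `s_a : W_a → Q_i` with `i = idx a`, one around each point `a`
of `M`. -/
structure LocalSections {E : Type v} [NormedAddCommGroup E] [NormedSpace ℝ E]
    {M : Type u} [TopologicalSpace M] [ChartedSpace E M] {ι : Type*} {U : ι → Opens M}
    (D : TwoDescentData (E := E) U) where
  idx : M → ι
  W : M → Opens M
  mem_W : ∀ a, a ∈ W a
  W_subset : ∀ a, (W a : Set M) ⊆ (chartAt E a).source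
  s : ∀ a, W a → (D.Q (idx a)).X
  smooth_s : ∀ a, ContMDiff 𝓘(ℝ, E) 𝓘(ℝ, (D.Q (idx a)).V) ∞ (s a)
  π_s : ∀ a m, (D.Q (idx a)).π (s a m) = m

variable {E : Type v} [NormedAddCommGroup E] [NormedSpace ℝ E]
  {M : Type u} [TopologicalSpace M] [ChartedSpace E M] {ι : Type*} {U : ι → Opens M}
  {D : TwoDescentData (E := E) U}

theorem nonempty_localSections (hU : ∀ m : M, ∃ i, m ∈ U i) : Nonempty D.LocalSections := by
  have key : ∀ a : M, ∃ (i : ι) (W : Opens M) (s : W → (D.Q i).X), a ∈ W ∧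
      (W : Set M) ⊆ (chartAt E a).source ∧ ContMDiff 𝓘(ℝ, E) 𝓘(ℝ, (D.Q i).V) ∞ s ∧
      ∀ m, (D.Q i).π (s m) = m := fun a => by
    obtain ⟨i, hi⟩ := hU a
    have ha : a ∈ Set.range (D.Q i).π := by rw [(D.Q i).range_π]; exact hi
    obtain ⟨x, rfl⟩ := ha
    obtain ⟨W, s, hW, hx, hs, -, hπ⟩ := (D.Q i).exists_section x
    refine ⟨i, ⟨W ∩ (chartAt E ((D.Q i).π x)).source, hW.inter (chartAt E _).open_source⟩,
      fun m => s m, ⟨hx, mem_chart_source E _⟩, Set.inter_subset_right, fun m => ?_,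
      fun m => hπ m m.2.1⟩
    exact contMDiffAt_subtype_iff.2 (hs.contMDiffAt (hW.mem_nhds m.2.1))
  choose idx W s h₁ h₂ h₃ h₄ using key
  exact ⟨⟨idx, W, h₁, h₂, s, h₃, h₄⟩⟩

namespace LocalSections

variable (S : D.LocalSections)

/-- The disjoint union of the domains of the local sections. -/
def Total : Type u := Σ a, S.W a

instance : TopologicalSpace S.Total := inferInstanceAs (TopologicalSpace (Σ a, S.W a))

instance [T2Space M] : T2Space S.Total := inferInstanceAs (T2Space (Σ a, S.W a))

noncomputable instance : ChartedSpace E S.Total :=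
  sigmaChartedSpace (X := fun a => S.W a)

instance [IsManifold 𝓘(ℝ, E) ∞ M] : IsManifold 𝓘(ℝ, E) ∞ S.Total :=
  isManifold_sigma (X := fun a => S.W a)

/-- Each `W_a` lies in a chart domain, so it embeds in `E` and is metrizable. -/
instance : ParacompactSpace S.Total :=
  have : ∀ a, TopologicalSpace.MetrizableSpace (S.W a) := fun a =>
    metrizableSpace_of_le_chartAt_source (S.W_subset a)
  paracompactSpace_sigma_of_metrizable (X := fun a => S.W a)

/-- The projection to `M`. -/
def π (x : S.Total) : M := x.2

theorem smooth_π : ContMDiff 𝓘(ℝ, E) 𝓘(ℝ, E) ∞ S.π :=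
  letI := sigmaChartedSpace (H := E) (X := fun a => S.W a)
  contMDiff_sigma (X := fun a => S.W a) fun _ => contMDiff_subtype_val

/-- The value of the local section at a point of the disjoint union. -/
def pt (x : S.Total) : (D.Q (S.idx x.1)).X := S.s x.1 x.2

theorem π_pt (x : S.Total) : (D.Q (S.idx x.1)).π (S.pt x) = S.π x := S.π_s _ _

/-- The inclusion of the domain of a local section. -/
def ofW (a : M) (m : S.W a) : S.Total := ⟨a, m⟩

theorem smooth_ofW (a : M) :
    ContMDiff 𝓘(ℝ, E) 𝓘(ℝ, E) ∞ (S.ofW a) :=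
  letI := sigmaChartedSpace (H := E) (X := fun a => S.W a)
  contMDiff_sigmaMk (X := fun a => S.W a) a

theorem isOpenEmbedding_ofW (a : M) :
    Topology.IsOpenEmbedding (S.ofW a) :=
  Topology.IsOpenEmbedding.sigmaMk (σ := fun a => S.W a) (i := a)

variable {S} {N : Opens M} {a b : M}

/-- The inclusion of an open subset of the domain of a local section. -/
def inc (ha : N ≤ S.W a) (n : N) : S.Total := S.ofW a ⟨n, ha n.2⟩

theorem isOpenEmbedding_inc (ha : N ≤ S.W a) : Topology.IsOpenEmbedding (inc ha) :=
  (S.isOpenEmbedding_ofW a).comp (TopologicalSpace.Opens.isOpenEmbedding_of_le ha)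

/-- The restriction of a local section to an open subset of its domain. -/
def sec (ha : N ≤ S.W a) (n : N) : (D.Q (S.idx a)).X := S.s a ⟨n, ha n.2⟩

theorem smooth_sec (ha : N ≤ S.W a) : ContMDiff 𝓘(ℝ, E) 𝓘(ℝ, (D.Q (S.idx a)).V) ∞ (sec ha) :=
  (S.smooth_s a).comp (contMDiff_inclusion ha)

theorem π_sec (ha : N ≤ S.W a) (n : N) : (D.Q (S.idx a)).π (sec ha n) = n := S.π_s _ _

theorem eventually_exists_inc (ha : N ≤ S.W a) (n : N) :
    ∀ᶠ x in 𝓝 (inc ha n), ∃ n' : N, inc ha n' = x :=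
  (isOpenEmbedding_inc ha).isOpen_range.mem_nhds ⟨n, rfl⟩

/-- Near `(inc ha n, inc hb n)`, the fibre product over `M` is a copy of `N`. Statements about pairs
with equal projection thereby reduce to statements over `N`. -/
theorem eventually_exists_inc₂ {Z : Type*} {l : Filter Z} (ha : N ≤ S.W a)
    (hb : N ≤ S.W b) (n : N) {p q : Z → S.Total} (hp : Filter.Tendsto p l (𝓝 (inc ha n)))
    (hq : Filter.Tendsto q l (𝓝 (inc hb n))) (h : ∀ᶠ z in l, S.π (p z) = S.π (q z)) :
    ∀ᶠ z in l, ∃ n' : N, inc ha n' = p z ∧ inc hb n' = q z := by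
  filter_upwards [hp.eventually (eventually_exists_inc ha n),
    hq.eventually (eventually_exists_inc hb n), h]
  rintro z ⟨n₁, h₁⟩ ⟨n₂, h₂⟩ h₃
  rw [← h₁, ← h₂] at h₃
  obtain rfl : n₁ = n₂ := Subtype.ext h₃
  exact ⟨n₁, h₁, h₂⟩

/-- Sections, over an open set `N`, of the glued `ℂˣ`-bundle. -/
abbrev Sec (ha : N ≤ S.W a) (hb : N ≤ S.W b) : Type u :=
  ∀ n, D.Fib (sec ha n) (sec hb n)

theorem exists_smoothAt (ha : N ≤ S.W a) (hb : N ≤ S.W b) (n : N) :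
    ∃ t : Sec ha hb, SmoothAt (E' := E) t n :=
  TwoDescentData.exists_smoothAt (smooth_sec ha).contMDiffAt (smooth_sec hb).contMDiffAt
    fun n => (π_sec ha n).trans (π_sec hb n).symm

variable (S)

/-- The atlas of the glued `ℂˣ`-bundle: the equivariant functions that take smooth sections to
smooth functions. -/
def atlas : Set (Opens (S.Total × S.Total) ×
    (∀ z : S.Total × S.Total, D.Fib (S.pt z.1) (S.pt z.2) → ℂˣ)) :=
  {τ | (∀ z ∈ τ.1, ∀ (c : ℂˣ) (a : D.Fib (S.pt z.1) (S.pt z.2)), τ.2 z (c • a) = c * τ.2 z a) ∧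
    ∀ {N : Opens M} {a b : M} (ha : N ≤ S.W a) (hb : N ≤ S.W b) (t : Sec ha hb) (n : N),
      (inc ha n, inc hb n) ∈ τ.1 → SmoothAt (E' := E) t n →
      ContMDiffAt 𝓘(ℝ, E) 𝓘(ℝ, ℂ) ∞
        (fun n => (τ.2 (inc ha n, inc hb n) (t n) : ℂ)) n}

variable {S}

/-- A trivialisation of the bundle of `Q_i`, with `i = idx b`, around `(φ(s_a(n)), s_b(n))` induces
one of the glued bundle. -/
theorem exists_mem_atlas (ha : N ≤ S.W a) (hb : N ≤ S.W b) (n : N) :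
    ∃ τ ∈ S.atlas, (inc ha n, inc hb n) ∈ τ.1 := by
  classical
  have hN : ∀ n : N, (D.Q (S.idx a)).π (sec ha n) ∈ U (S.idx b) := fun n => by
    have h := π_mem (sec hb n)
    erw [π_sec hb] at h
    exact (π_sec ha n).symm ▸ h
  let f : N → (D.Q (S.idx b)).X × (D.Q (S.idx b)).X := fun n =>
    (D.lift (sec ha n) (S.idx b) (hN n), sec hb n)
  have hf : Continuous f := by
    refine Continuous.prodMk ?_ (smooth_sec hb).continuous
    exact continuous_iff_continuousAt.2 fun n =>
      (contMDiffAt_lift (smooth_sec ha).contMDiffAt hN).continuousAt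
  obtain ⟨τ, hτ, hτ₀⟩ := (D.Q (S.idx b)).P.exists_mem_atlas (f n)
    ((D.π_lift _ (hN n)).trans ((π_sec ha n).trans (π_sec hb n).symm))
  let N' : Opens N := ⟨f ⁻¹' τ.1, τ.1.isOpen.preimage hf⟩
  let O : Opens (S.Total × S.Total) := ⟨(inc ha '' N') ×ˢ (inc hb '' N'),
    ((isOpenEmbedding_inc ha).isOpenMap _ N'.isOpen).prod
      ((isOpenEmbedding_inc hb).isOpenMap _ N'.isOpen)⟩
  -- The trivialisation must be defined on all fibres, whose types vary with the second summand. It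
  -- is `τ` on the summand `b` and `1` elsewhere; the second factor of `O` lies in the summand `b`.
  let T : ∀ c, (∀ q, (D.Q (S.idx c)).P.fib q → ℂˣ) := Function.update (fun _ _ _ => 1) b τ.2
  have hT : T b = τ.2 := Function.update_self _ _ _
  refine ⟨⟨O, fun z p => T z.2.1 _ p.val⟩, ⟨?_, ?_⟩, ⟨n, hτ₀, rfl⟩, ⟨n, hτ₀, rfl⟩⟩
  · rintro ⟨x, y⟩ ⟨⟨n₁, hn₁, rfl⟩, ⟨n₂, hn₂, rfl⟩⟩ c (p : D.Fib (sec ha n₁) (sec hb n₂))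
    obtain rfl : n₁ = n₂ := by
      have := p.π_eq
      rw [π_sec, π_sec] at this
      exact Subtype.ext this
    change T b _ (c • p.val) = c * T b _ p.val
    rw [hT]
    exact (D.Q (S.idx b)).P.equivariant τ hτ _ hn₁ c p.val
  · rintro N₁ a₁ b₁ ha₁ hb₁ t n₁ ⟨⟨n₂, hn₂, h₂⟩, ⟨n₃, hn₃, h₃⟩⟩ ht
    obtain rfl : a = a₁ := congrArg Sigma.fst h₂
    obtain rfl : b = b₁ := congrArg Sigma.fst h₃
    change ContMDiffAt 𝓘(ℝ, E) 𝓘(ℝ, ℂ) ∞ (fun n => (T b _ (t n).val : ℂ)) n₁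
    rw [hT]
    refine ht τ hτ ?_
    have h₄ : (n₂ : M) = n₁ := congrArg S.π h₂
    obtain ⟨n₁, hn₁⟩ := n₁
    subst h₄
    exact hn₂

end LocalSections

end TwoDescentData

/-! ### The glued bundle gerbe, the morphisms `χ_i` and the transformations `ξ_ij`. -/

namespace TwoDescentData

open BundleGerbe

variable {E : Type v} [NormedAddCommGroup E] [NormedSpace ℝ E]
  {M : Type u} [TopologicalSpace M] [ChartedSpace E M] {ι : Type*} {U : ι → Opens M}
  {D : TwoDescentData (E := E) U}

namespace LocalSections

variable {S : D.LocalSections}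

/-- On the open image of `inc ha`, the projection to `M` is a smooth inverse of `inc ha`, so `f` is
locally its pullback to `N` composed with the projection. -/
theorem contMDiffAt_of_comp_inc {Y : Type*} [TopologicalSpace Y] {F H : Type*}
    [NormedAddCommGroup F] [NormedSpace ℝ F] [TopologicalSpace H] {K : ModelWithCorners ℝ F H}
    [ChartedSpace H Y] {O : Opens S.Total} {f : O → Y} {N : Opens M} {a : M} (ha : N ≤ S.W a)
    (hO : ∀ n, inc ha n ∈ O) {n : N}
    (h : ContMDiffAt 𝓘(ℝ, E) K ∞ (fun n => f ⟨inc ha n, hO n⟩) n) :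
    ContMDiffAt 𝓘(ℝ, E) K ∞ f ⟨inc ha n, hO n⟩ := by
  refine contMDiffWithinAt_univ.1 (h.contMDiffWithinAt_comp_opens (q := fun x : O => S.π x)
    ((S.smooth_π.comp contMDiff_subtype_val) _) rfl trivial ?_)
  rw [nhdsWithin_univ]
  filter_upwards [continuous_subtype_val.continuousAt.eventually (eventually_exists_inc ha n)]
  rintro ⟨_, _⟩ ⟨n', rfl⟩ _
  rfl

theorem exists_inc₂ {x y : S.Total} (h : S.π x = S.π y) :
    ∃ (N : Opens M) (a b : M) (ha : N ≤ S.W a) (hb : N ≤ S.W b) (n : N),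
      inc ha n = x ∧ inc hb n = y := by
  obtain ⟨a, m, hm⟩ := x
  obtain ⟨b, m', hm'⟩ := y
  obtain rfl : m = m' := h
  exact ⟨S.W a ⊓ S.W b, a, b, inf_le_left, inf_le_right, ⟨m, hm, hm'⟩, rfl, rfl⟩

theorem exists_inc₃ {x y z : S.Total} (hxy : S.π x = S.π y) (hyz : S.π y = S.π z) :
    ∃ (N : Opens M) (a b c : M) (ha : N ≤ S.W a) (hb : N ≤ S.W b) (hc : N ≤ S.W c) (n : N),
      inc ha n = x ∧ inc hb n = y ∧ inc hc n = z := by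
  obtain ⟨a, m, hm⟩ := x
  obtain ⟨b, m', hm'⟩ := y
  obtain ⟨c, m'', hm''⟩ := z
  obtain rfl : m = m' := hxy
  obtain rfl : m = m'' := hyz
  exact ⟨S.W a ⊓ S.W b ⊓ S.W c, a, b, c, inf_le_left.trans inf_le_left,
    inf_le_left.trans inf_le_right, inf_le_right, ⟨m, ⟨hm, hm'⟩, hm''⟩, rfl, rfl, rfl⟩

variable (S)

/-- The glued `ℂˣ`-bundle. -/
noncomputable def bundle : PrincipalBundle (𝓘(ℝ, E).prod 𝓘(ℝ, E)) (S.Total × S.Total)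
    {p | S.π p.1 = S.π p.2} where
  fib p := D.Fib (S.pt p.1) (S.pt p.2)
  nonempty_fib_iff p := by
    rw [Fib.nonempty_iff, π_pt, π_pt]; rfl
  existsUnique_smul a b := Fib.existsUnique_smul a b
  atlas := S.atlas
  equivariant τ hτ z hz c a := hτ.1 z hz c a
  exists_mem_atlas := by
    rintro ⟨x, y⟩ h
    obtain ⟨N, a, b, ha, hb, n, rfl, rfl⟩ := exists_inc₂ h
    exact exists_mem_atlas ha hb n
  smooth_transition τ hτ σ hσ := by
    rintro ⟨x, y⟩ h hτ₀ hσ₀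
    obtain ⟨N, a, b, ha, hb, n, rfl, rfl⟩ := exists_inc₂ h
    obtain ⟨t, ht⟩ := exists_smoothAt ha hb n
    -- The transition function is the ratio of the two components of the smooth section `t`, as a
    -- function of the base point.
    obtain ⟨g, hg, hg'⟩ := ((hσ.2 ha hb t n hσ₀ ht).units_div
      (hτ.2 ha hb t n hτ₀ ht)).exists_units_extension {p : S.Total × S.Total | S.π p.1 = S.π p.2}
      (J := 𝓘(ℝ, E).prod 𝓘(ℝ, E)) (q := fun p : S.Total × S.Total => S.π p.1)
      (z := (inc ha n, inc hb n)) (S.smooth_π.comp contMDiff_fst).contMDiffAt.contMDiffWithinAt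
      rfl rfl
    refine ⟨g, hg, ?_⟩
    have h₁ := eventually_exists_inc₂ ha hb n
      (l := 𝓝[{p : S.Total × S.Total | S.π p.1 = S.π p.2}] (inc ha n, inc hb n))
      (continuous_fst.continuousWithinAt) (continuous_snd.continuousWithinAt)
      eventually_mem_nhdsWithin
    filter_upwards [h₁, mem_nhdsWithin_of_mem_nhds (τ.1.isOpen.mem_nhds hτ₀),
      mem_nhdsWithin_of_mem_nhds (σ.1.isOpen.mem_nhds hσ₀)]
    rintro ⟨_, _⟩ ⟨n', rfl, rfl⟩ hτ' hσ' p
    obtain ⟨c, rfl, -⟩ := Fib.existsUnique_smul (t n') p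
    have h₂ := hg' (inc ha n', inc hb n') n'.2
    have h₃ := hσ.1 _ hσ' c (t n')
    have h₄ := hτ.1 _ hτ' c (t n')
    rw [h₂]
    refine h₃.trans (Eq.trans ?_ (congrArg _ h₄.symm))
    rw [mul_left_comm]
    exact congrArg _ (div_mul_cancel _ _).symm

/-- The part of the disjoint union over an open subset of `M`. -/
def preimage (V : Opens M) : Opens S.Total :=
  ⟨S.π ⁻¹' V, V.isOpen.preimage S.smooth_π.continuous⟩

theorem contMDiff_lift_pt (i : ι) : ContMDiff 𝓘(ℝ, E) 𝓘(ℝ, (D.Q i).V) ∞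
    (fun x : S.preimage (U i) => D.lift (S.pt x) i ((S.π_pt _).symm ▸ x.2)) := by
  rintro ⟨⟨a, m, hm⟩, hi⟩
  have ha : S.W a ⊓ U i ≤ S.W a := inf_le_left
  exact contMDiffAt_of_comp_inc (O := S.preimage (U i)) ha (fun n => n.2.2)
    (n := ⟨m, hm, hi⟩) (contMDiffAt_lift (smooth_sec ha).contMDiffAt
      fun n => (π_sec ha n).symm ▸ n.2.2)

/-- The glued bundle gerbe. -/
noncomputable def gerbe [CompleteSpace E] [IsManifold 𝓘(ℝ, E) ∞ M] [T2Space M] :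
    BundleGerbe (E := E) (⊤ : Opens M) where
  V := E
  X := S.Total
  π := S.π
  smooth_π := S.smooth_π
  range_π := by
    ext m
    exact ⟨fun _ => trivial, fun _ => ⟨S.ofW m ⟨m, S.mem_W m⟩, rfl⟩⟩
  exists_section x := by
    classical
    refine ⟨S.W x.1, fun m => if h : m ∈ S.W x.1 then S.ofW x.1 ⟨m, h⟩ else x,
      (S.W x.1).isOpen, x.2.2, fun m hm => ?_, dif_pos x.2.2, fun m hm => ?_⟩
    · refine ContMDiffAt.contMDiffWithinAt ?_
      refine (contMDiffAt_subtype_iff (x := ⟨m, hm⟩)).1 ?_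
      refine (S.smooth_ofW x.1).contMDiffAt.congr_of_eventuallyEq (.of_forall fun m => ?_)
      exact dif_pos m.2
    · exact congrArg S.π (dif_pos hm)
  P := S.bundle
  mul b a := Fib.mul b a
  smul_mul c b a := Fib.smul_mul c b a
  mul_smul c b a := Fib.mul_smul c b a
  smooth_mul x y z hxy hyz τ hτ σ hσ ρ hρ hτ₀ hσ₀ hρ₀ := by
    obtain ⟨N, a, b, c, ha, hb, hc, n, rfl, rfl, rfl⟩ := exists_inc₃ hxy hyz
    obtain ⟨t, ht⟩ := exists_smoothAt ha hb n
    obtain ⟨u, hu⟩ := exists_smoothAt hb hc n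
    have hut := hu.mul (smooth_sec ha).contMDiffAt (smooth_sec hb).contMDiffAt
      (smooth_sec hc).contMDiffAt ht
    let R : Set (S.Total × S.Total × S.Total) := {p | S.π p.1 = S.π p.2.1 ∧ S.π p.2.1 = S.π p.2.2}
    -- The product in trivialisations is read off from the sections `u`, `t` and their product;
    -- other elements are multiples of these, and the scalars cancel by bilinearity.
    obtain ⟨g, hg, hg'⟩ := ((hρ.2 ha hc _ n hρ₀ hut).units_div
      ((hτ.2 hb hc u n hτ₀ hu).units_mul (hσ.2 ha hb t n hσ₀ ht))).exists_units_extension R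
      (J := 𝓘(ℝ, E).prod (𝓘(ℝ, E).prod 𝓘(ℝ, E)))
      (q := fun p : S.Total × S.Total × S.Total => S.π p.1)
      (z := (inc ha n, inc hb n, inc hc n))
      (S.smooth_π.comp contMDiff_fst).contMDiffAt.contMDiffWithinAt rfl ⟨rfl, rfl⟩
    refine ⟨g, hg, ?_⟩
    have hR : ∀ᶠ p in 𝓝[R] (inc ha n, inc hb n, inc hc n), p ∈ R := eventually_mem_nhdsWithin
    have h₁ := eventually_exists_inc₂ ha hb n (l := 𝓝[R] (inc ha n, inc hb n, inc hc n))
      continuous_fst.continuousWithinAt (continuous_fst.comp continuous_snd).continuousWithinAt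
      (hR.mono fun p hp => hp.1)
    have h₂ := eventually_exists_inc₂ hb hc n (l := 𝓝[R] (inc ha n, inc hb n, inc hc n))
      (continuous_fst.comp continuous_snd).continuousWithinAt
      (continuous_snd.comp continuous_snd).continuousWithinAt (hR.mono fun p hp => hp.2)
    have hτ₁ : ∀ᶠ p : S.Total × S.Total × S.Total in 𝓝[R] (inc ha n, inc hb n, inc hc n),
        (p.2.1, p.2.2) ∈ τ.1 :=
      mem_nhdsWithin_of_mem_nhds (continuous_snd.continuousAt.preimage_mem_nhds
        (τ.1.isOpen.mem_nhds hτ₀))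
    have hσ₁ : ∀ᶠ p : S.Total × S.Total × S.Total in 𝓝[R] (inc ha n, inc hb n, inc hc n),
        (p.1, p.2.1) ∈ σ.1 :=
      mem_nhdsWithin_of_mem_nhds ((continuous_fst.prodMk
        (continuous_fst.comp continuous_snd)).continuousAt.preimage_mem_nhds
        (σ.1.isOpen.mem_nhds hσ₀))
    have hρ₁ : ∀ᶠ p : S.Total × S.Total × S.Total in 𝓝[R] (inc ha n, inc hb n, inc hc n),
        (p.1, p.2.2) ∈ ρ.1 :=
      mem_nhdsWithin_of_mem_nhds ((continuous_fst.prodMk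
        (continuous_snd.comp continuous_snd)).continuousAt.preimage_mem_nhds
        (ρ.1.isOpen.mem_nhds hρ₀))
    filter_upwards [h₁, h₂, hτ₁, hσ₁, hρ₁]
    rintro ⟨_, _, _⟩ ⟨n', rfl, rfl⟩ ⟨n'', h, rfl⟩ hτ' hσ' hρ' q p
    obtain rfl := (isOpenEmbedding_inc hb).injective h
    obtain ⟨c, rfl, -⟩ := Fib.existsUnique_smul (t n'') p
    obtain ⟨d, rfl, -⟩ := Fib.existsUnique_smul (u n'') q
    have h₃ := hρ.1 _ hρ' (d * c) (Fib.mul (u n'') (t n''))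
    have h₄ := hτ.1 _ hτ' d (u n'')
    have h₅ := hσ.1 _ hσ' c (t n'')
    have h₆ : Fib.mul (d • u n'') (c • t n'') = (d * c) • Fib.mul (u n'') (t n'') := by
      rw [Fib.smul_mul, Fib.mul_smul, smul_smul]
    rw [hg' (inc ha n'', inc hb n'', inc hc n'') n''.2]
    refine (congrArg _ h₆).trans (h₃.trans (Eq.trans ?_ (congrArg _ (congrArg₂ _ h₄ h₅).symm)))
    rw [mul_mul_mul_comm d, mul_left_comm]
    exact congrArg _ (div_mul_cancel _ _).symm
  mul_assoc c b a := Fib.mul_assoc c b a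

variable [CompleteSpace E] [IsManifold 𝓘(ℝ, E) ∞ M] [T2Space M]

/-- The morphisms from the glued bundle gerbe to the given ones. -/
noncomputable def χ (i : ι) : Hom (U i) S.gerbe (D.Q i) where
  f x := D.lift (S.pt x.1) i ((S.π_pt _).symm ▸ x.2)
  smooth_f := S.contMDiff_lift_pt i
  π_f x := (D.π_lift _ _).trans (S.π_pt _)
  fhat {x y} a := Fib.hat a i ((S.π_pt _).symm ▸ x.2) ((S.π_pt _).symm ▸ y.2)
  fhat_smul c a := Fib.hat_smul c a _ _
  smooth_fhat := by
    rintro ⟨⟨a, m, hm⟩, hi⟩ ⟨⟨b, m', hm'⟩, hi'⟩ h τ hτ σ hσ hτ₀ hσ₀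
    obtain rfl : m = m' := h
    have ha : S.W a ⊓ S.W b ⊓ U i ≤ S.W a := inf_le_left.trans inf_le_left
    have hb : S.W a ⊓ S.W b ⊓ U i ≤ S.W b := inf_le_left.trans inf_le_right
    let n : (S.W a ⊓ S.W b ⊓ U i : Opens M) := ⟨m, ⟨hm, hm'⟩, hi⟩
    obtain ⟨t, ht⟩ := exists_smoothAt ha hb n
    have hat := ht.hat (k := i) (smooth_sec ha).contMDiffAt (smooth_sec hb).contMDiffAt
      (fun n => (π_sec ha n).symm ▸ n.2.2) (fun n => (π_sec hb n).symm ▸ n.2.2) σ hσ hσ₀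
    let X : Opens S.Total := S.preimage (U i)
    let x₀ : X := ⟨inc ha n, hi⟩
    let y₀ : X := ⟨inc hb n, hi⟩
    let R : Set (X × X) := {p | S.π p.1 = S.π p.2}
    -- The ratio of the components of `t̂_i` and of `t` represents the bundle map.
    obtain ⟨g, hg, hg'⟩ := (hat.units_div (hτ.2 ha hb t n hτ₀ ht)).exists_units_extension R
      (J := 𝓘(ℝ, E).prod 𝓘(ℝ, E)) (q := fun p : X × X => S.π p.1) (z := (x₀, y₀))
      (S.smooth_π.comp (contMDiff_subtype_val.comp contMDiff_fst)).contMDiffAt.contMDiffWithinAt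
      rfl rfl
    refine ⟨g, hg, ?_⟩
    have hx : Continuous fun p : X × X => (p.1 : S.Total) :=
      continuous_subtype_val.comp continuous_fst
    have hy : Continuous fun p : X × X => (p.2 : S.Total) :=
      continuous_subtype_val.comp continuous_snd
    have h₁ := eventually_exists_inc₂ ha hb n (l := 𝓝[R] (x₀, y₀)) hx.continuousWithinAt
      hy.continuousWithinAt eventually_mem_nhdsWithin
    have hτ₁ : ∀ᶠ p : X × X in 𝓝[R] (x₀, y₀), ((p.1 : S.Total), (p.2 : S.Total)) ∈ τ.1 :=
      mem_nhdsWithin_of_mem_nhds ((hx.prodMk hy).continuousAt.preimage_mem_nhds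
        (τ.1.isOpen.mem_nhds hτ₀))
    have hσ₁ : ∀ᶠ p : X × X in 𝓝[R] (x₀, y₀),
        (D.lift (S.pt p.1) i ((S.π_pt _).symm ▸ p.1.2),
          D.lift (S.pt p.2) i ((S.π_pt _).symm ▸ p.2.2)) ∈ σ.1 :=
      mem_nhdsWithin_of_mem_nhds ((((S.contMDiff_lift_pt i).continuous.comp continuous_fst).prodMk
        ((S.contMDiff_lift_pt i).continuous.comp continuous_snd)).continuousAt.preimage_mem_nhds
        (σ.1.isOpen.mem_nhds hσ₀))
    filter_upwards [h₁, hτ₁, hσ₁]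
    rintro ⟨⟨_, _⟩, ⟨_, _⟩⟩ ⟨n', rfl, rfl⟩ hτ' hσ' p
    obtain ⟨c, rfl, -⟩ := Fib.existsUnique_smul (t n') p
    have h₂ := hg' (⟨inc ha n', n'.2.2⟩, ⟨inc hb n', n'.2.2⟩) n'.2
    have h₃ := (D.Q i).P.equivariant σ hσ _ hσ' c ((t n').hat i
      ((π_sec ha n').symm ▸ n'.2.2) ((π_sec hb n').symm ▸ n'.2.2))
    have h₄ := hτ.1 _ hτ' c (t n')
    have h₅ := Fib.hat_smul c (t n')
      (k := i) ((π_sec ha n').symm ▸ n'.2.2) ((π_sec hb n').symm ▸ n'.2.2)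
    refine (congrArg _ h₅).trans (h₃.trans (Eq.trans ?_ (congrArg₂ (· * ·) h₂ h₄).symm))
    dsimp only
    rw [mul_left_comm]
    exact congrArg _ (div_mul_cancel _ _).symm
  fhat_mul b a := Fib.hat_mul b a _ _ _

/-- The transformations between the morphisms `φ_ij ∘ χ_i` and `χ_j`. -/
noncomputable def ξ (i j : ι) : Trans (V := U i ⊓ U j)
    ((D.φ i j).comp ((S.χ i).res inf_le_left)) ((S.χ j).res inf_le_right) where
  app x := D.coh (S.pt x.1) i j ((S.π_pt _).symm ▸ x.2.1) ((S.π_pt _).symm ▸ x.2.2)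
  smooth_app := by
    rintro ⟨⟨a, m, hm⟩, hij⟩ τ hτ h₀
    have ha : S.W a ⊓ (U i ⊓ U j) ≤ S.W a := inf_le_left
    exact contMDiffAt_of_comp_inc (O := S.preimage (U i ⊓ U j)) ha (fun n => n.2.2)
      (n := ⟨m, hm, hij⟩) (smoothAt_coh (smooth_sec ha).contMDiffAt
        (fun n => (π_sec ha n).symm ▸ n.2.2.1) (fun n => (π_sec ha n).symm ▸ n.2.2.2) τ hτ h₀)
  naturality a := Fib.hat_naturality a _ _ _ _

end LocalSections

end TwoDescentData

/-! ### The theorem. -/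

theorem mainTheorem6 {E : Type v} [NormedAddCommGroup E] [NormedSpace ℝ E] [CompleteSpace E]
    {M : Type u} [TopologicalSpace M] [ChartedSpace E M] [IsManifold 𝓘(ℝ, E) ∞ M]
    [T2Space M] [ParacompactSpace M]
    {ι : Type*} (U : ι → Opens M) (hU : ∀ m : M, ∃ i, m ∈ U i)
    (D : TwoDescentData (E := E) U) :
    ∃ (Q : BundleGerbe (E := E) (⊤ : Opens M))
      (χ : ∀ i, BundleGerbe.Hom (U i) Q (D.Q i))
      (ξ : ∀ i j, BundleGerbe.Trans (V := U i ⊓ U j)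
        ((D.φ i j).comp ((χ i).res inf_le_left)) ((χ j).res inf_le_right)),
      (∀ i j k,
        have hi : U i ⊓ U j ⊓ U k ≤ U i := inf_le_left.trans inf_le_left
        have hij : U i ⊓ U j ⊓ U k ≤ U i ⊓ U j := inf_le_left
        have hjk : U i ⊓ U j ⊓ U k ≤ U j ⊓ U k :=
          le_inf (inf_le_left.trans inf_le_right) inf_le_right
        have hik : U i ⊓ U j ⊓ U k ≤ U i ⊓ U k := le_inf hi inf_le_right
        BundleGerbe.Trans.vcomp ((ξ j k).res hjk)
            (BundleGerbe.Trans.whiskerLeft ((D.φ j k).res hjk) ((ξ i j).res hij)) =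
          BundleGerbe.Trans.vcomp ((ξ i k).res hik)
            (BundleGerbe.Trans.whiskerRight (D.ψ i j k) ((χ i).res hi))) ∧
      (FiniteDimensional ℝ E → (∀ i, FiniteDimensional ℝ (D.Q i).V) →
        FiniteDimensional ℝ Q.V) := by
  obtain ⟨S⟩ := D.nonempty_localSections hU
  refine ⟨S.gerbe, S.χ, S.ξ, fun i j k => ?_, fun h _ => h⟩
  have hext : ∀ {V U₁ U₂ : Opens M} {P : BundleGerbe (E := E) U₁} {Q : BundleGerbe (E := E) U₂}
      {f g : BundleGerbe.Hom V P Q} (θ η : BundleGerbe.Trans f g), θ.app = η.app → θ = η := by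
    rintro _ _ _ _ _ _ _ ⟨⟩ ⟨⟩ rfl
    rfl
  refine hext _ _ (funext fun x => ?_)
  -- All terms are values of `ψ`, so the equation at `x` is the cocycle condition at the point `S.pt
  -- x.1`, with first index that of the local section.
  exact D.coh_cocycle (S.pt x.1) ((S.π_pt _).symm ▸ x.2.1.1) ((S.π_pt _).symm ▸ x.2.1.2)
    ((S.π_pt _).symm ▸ x.2.2)
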